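/- **Setting.** Let $n,m\ge 1$, let $A^{(1)},\dots,A^{(m)}\in\mathbb R^{n\times n}$, and let $S,Y\in\mathbb R^{n\times n}$ be symmetric with $Y$ invertible. For $Z\in\mathbb R^{n\times n}$ with columns $Z_1,\dots,Z_n$ let $\widetilde Z,\widehat Z\in\mathbb R^{n^2\times n^2}$ be the matrices whose rows, indexed by $(i,j)\in[n]\times[n]$, are $\widetilde Z_{ij}=(e_i\otimes Z_j)^T$ and $\widehat Z_{ij}=(e_j\otimes Z_i)^T$. Let $\mathcal A\in\mathbb R^{m\times n^2}$ have the rows $\mathrm{vec}(A^{(k)})^T$, where $\mathrm{vec}(A^{(k)})_{(i,j)}=A^{(k)}_{ij}$. Put $$M_2=\begin{pmatrix}\mathcal A^T & \widetilde{Y^{-1}}\,\widehat S\\ 0&\mathcal A\end{pmatrix}\in\mathbb R^{N\times N},\qquad N=n^2+m .$$ **QRAM data structures.** For a finite family of reals whose positions are given by bit strings of equal length, the data structure is the binary tree in which the node reached by the bit string $w$ holds the sum of the squares of the entries whose positions begin with $w$, and each leaf also holds the sign of its entry. A matrix is stored in this way with an entry's row index followed by its column index as its position (a tree for each row, and a tree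 over the squared norms of the rows). The QRAM holds such data structures for $Y$, $S$, $Y^{-1}$, for each $A^{(k)}$ separately, and for the matrix with the $n^2$ rows $\mathcal A_{i,j}=(A^{(k)}_{ij})_{k\in[m]}$. **Circuits and time.** A circuit is a finite sequence of steps. A step applies to one target qubit the gate $\frac1{\sqrt{x^2+y^2}}\begin{pmatrix}x&y\\y&-x\end{pmatrix}$ (the identity if $x=y=0$), where $x,y$ are computed, in each computational basis state of the other qubits, by exact real arithmetic (integer constants, bits of the register, $+$, $\times$, $\sqrt{\cdot}$, comparison) from words of the QRAM queried at addresses formed by qubits and fixed bits. The time of a circuit is the number of operations: each arithmetic operation, QRAM query, address bit, bit of a constant and rotation has unit cost, up to a constant factor. **Block encodings.** A unitary $U$ on $t+\lceil\log_2 N\rceil$ qubits is a $(\mu,t,\delta)$ block encoding of $M\in\mathbb R^{N\times N}$ if $\|\mu\widetilde M-M\|\le\delta$ in spectral norm, where $\widetilde M$ is the block of $U$ in which the $t$ ancilla qubits are $|0\rangle$ and $M$ is extended by zero to $\lceil\log_2 N\rceil$ qubits. It is efficient if it is implemented in time polylogarithmic in the dimension $N$. **Theorem 7.1.** If $Y,S,A^{(k)}$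 and $Y^{-1}$ are stored in QRAM data structures, then there is an efficient $(\|M_2\|_F,O(\log N),0)$ block encoding of $M_2$. Precisely: there are constants $C,a$ such that for all $n,m\ge1$ there are $t\le C\log_2 N$ and a circuit on $t+\lceil\log_2 N\rceil$ qubits, of running time at most $C(\log_2 N)^a$ and depending on $n$ and $m$ only, which for all $A^{(k)},S,Y$ as above, with the QRAM holding their data structures, implements a $(\|M_2\|_F,t,0)$ block encoding of $M_2$. -/

import Mathlib

noncomputable section

namespace QuantumIPM

/-! ## Quantum circuits with a QRAM

The QRAM holds real words in named arrays: `mem a w` is the word of array `a` at the bit string `w`.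
A circuit acts on `q` qubits. One step rotates a single target qubit by an angle which is obtained
from the other qubits and from the QRAM by real arithmetic: in each branch of the superposition the
addressed words are read, the arithmetic is done, the rotation is made, and the work space is
uncomputed. Each bit of an address, each bit of a constant, each QRAM query, each arithmetic
operation and each rotation costs one unit of time. -/

/-- Straight-line real arithmetic on the bits of a register with `q` qubits and on QRAM words.
An address is a list of bits, each of them a qubit of the register or a fixed bit. -/
inductive AngleExpr (κ : Type) (q : ℕ) : Type
  /-- an integer constant -/
  | const (c : ℤ)
  /-- the value `0` or `1` of a qubit in the computational basis -/
  | bit (w : Fin q)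
  /-- a QRAM query -/
  | cell (a : κ) (addr : List (Fin q ⊕ Bool))
  | add (e₁ e₂ : AngleExpr κ q)
  | mul (e₁ e₂ : AngleExpr κ q)
  | sqrt (e : AngleExpr κ q)
  /-- the indicator of `e₁ ≤ e₂` -/
  | le (e₁ e₂ : AngleExpr κ q)

/-- The number of unit operations in an expression. -/
def AngleExpr.size {κ : Type} {q : ℕ} : AngleExpr κ q → ℕ
  | .const c => Nat.size c.natAbs + 1
  | .bit _ => 1
  | .cell _ addr => addr.length + 1
  | .add e₁ e₂ => e₁.size + e₂.size + 1
  | .mul e₁ e₂ => e₁.size + e₂.size + 1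
  | .sqrt e => e.size + 1
  | .le e₁ e₂ => e₁.size + e₂.size + 1

open Classical in
/-- The value of an expression when the QRAM holds `mem` and the qubits are in the basis state `b`. -/
def AngleExpr.eval {κ : Type} {q : ℕ} (mem : κ → List Bool → ℝ) (b : Fin q → Bool) :
    AngleExpr κ q → ℝ
  | .const c => c
  | .bit w => if b w then 1 else 0
  | .cell a addr => mem a (addr.map (Sum.elim b id))
  | .add e₁ e₂ => e₁.eval mem b + e₂.eval mem b
  | .mul e₁ e₂ => e₁.eval mem b * e₂.eval mem b
  | .sqrt e => Real.sqrt (e.eval mem b)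
  | .le e₁ e₂ => if e₁.eval mem b ≤ e₂.eval mem b then 1 else 0

/-- The one-qubit gate `(x² + y²)^(-1/2) [[x, y], [y, -x]]`, which sends `|0⟩` to the state
proportional to `x|0⟩ + y|1⟩`; it is the identity if `x = y = 0`. Special cases are `X` (`x = 0`,
`y = 1`), `Z` (`x = 1`, `y = 0`), the Hadamard gate (`x = y = 1`), and, with `x = 0` and `y` a product
of bits, the controlled and multiply controlled `X` gates. -/
def rotationGate (x y : ℝ) : Matrix Bool Bool ℝ :=
  if x = 0 ∧ y = 0 then 1
  else (Real.sqrt (x ^ 2 + y ^ 2))⁻¹ •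
    Matrix.of fun i j => cond i (cond j (-x) y) (cond j y x)

/-- One elementary step: the target qubit undergoes `rotationGate x y`, where the numbers `x` and `y`
are computed from the other qubits and the QRAM. -/
structure Gate (κ : Type) (q : ℕ) : Type where
  target : Fin q
  x : AngleExpr κ q
  y : AngleExpr κ q

/-- The time of one step. -/
def Gate.time {κ : Type} {q : ℕ} (g : Gate κ q) : ℕ := g.x.size + g.y.size + 1

/-- The operator of one step in the computational basis. The expressions are evaluated with the target
bit replaced by `0`, so that they depend on the other qubits only. -/
def Gate.toMatrix {κ : Type} {q : ℕ} (mem : κ → List Bool → ℝ) (g : Gate κ q) :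
    Matrix (Fin q → Bool) (Fin q → Bool) ℂ := fun b' b =>
  if ∀ w, w ≠ g.target → b' w = b w then
    ((rotationGate (g.x.eval mem (Function.update b g.target false))
      (g.y.eval mem (Function.update b g.target false)) (b' g.target) (b g.target) : ℝ) : ℂ)
  else 0

/-- A circuit is the list of its steps, in the order in which they are executed. -/
abbrev Circuit (κ : Type) (q : ℕ) : Type := List (Gate κ q)

/-- The running time of a circuit. -/
def Circuit.time {κ : Type} {q : ℕ} (c : Circuit κ q) : ℕ := (c.map Gate.time).sum

/-- The operator of a circuit. -/
def Circuit.toMatrix {κ : Type} {q : ℕ} (mem : κ → List Bool → ℝ) :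
    Circuit κ q → Matrix (Fin q → Bool) (Fin q → Bool) ℂ
  | [] => 1
  | g :: c => Circuit.toMatrix mem c * g.toMatrix mem

/-! ## Block encodings -/

/-- A `d × d` matrix as an operator on `⌈log₂ d⌉` qubits: a basis state is read as a binary number,
most significant bit first, and the matrix is extended by zero. -/
def qubitOperator {d : ℕ} (A : Matrix (Fin d) (Fin d) ℝ) :
    Matrix (Fin (Nat.clog 2 d) → Bool) (Fin (Nat.clog 2 d) → Bool) ℂ := fun x y =>
  if h : Nat.ofBits (fun i => x i.rev) < d ∧ Nat.ofBits (fun i => y i.rev) < d then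
    ((A ⟨_, h.1⟩ ⟨_, h.2⟩ : ℝ) : ℂ)
  else 0

/-- The top left block of an operator on `t + s` qubits, in which the first `t` qubits are `|0⟩`. -/
def topLeftBlock {t s : ℕ} (U : Matrix (Fin (t + s) → Bool) (Fin (t + s) → Bool) ℂ) :
    Matrix (Fin s → Bool) (Fin s → Bool) ℂ := fun x y =>
  U (Fin.append (fun _ => false) x) (Fin.append (fun _ => false) y)

open scoped Matrix.Norms.L2Operator in
/-- `U` is a `(μ, t, δ)` block encoding of `A`; the norm is the spectral norm. -/
def IsBlockEncoding {d : ℕ} (A : Matrix (Fin d) (Fin d) ℝ) (μ : ℝ) (t : ℕ) (δ : ℝ)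
    (U : Matrix (Fin (t + Nat.clog 2 d) → Bool) (Fin (t + Nat.clog 2 d) → Bool) ℂ) : Prop :=
  U ∈ Matrix.unitaryGroup (Fin (t + Nat.clog 2 d) → Bool) ℂ ∧
    ‖(μ : ℂ) • topLeftBlock U - qubitOperator A‖ ≤ δ

open scoped Matrix.Norms.Frobenius in
/-- The Frobenius norm. -/
def frobeniusNorm {d : ℕ} (A : Matrix (Fin d) (Fin d) ℝ) : ℝ := ‖A‖

/-! ## The QRAM data structures -/

/-- The `s` bit binary expansion of `i`, most significant bit first. -/
def bits (s i : ℕ) : List Bool := List.ofFn fun j : Fin s => i.testBit j.rev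

/-- The two words stored at a node of a tree: the sum of squares below it, and, at a leaf, the sign of
the entry. -/
inductive Field : Type
  | weight
  | sign

/-- The binary tree data structure for real numbers `v i` whose positions are the leaves `enc i` of a
binary tree. A node is named by the bit string `w` that leads to it from the root and holds the sum of
the squares of the entries below it; a leaf also holds the sign of its entry. Setting an entry changes
only the nodes on one path from the root to a leaf. -/
def treeStore {ι : Type} [Fintype ι] (enc : ι → List Bool) (v : ι → ℝ) : Field → List Bool → ℝ
  | .weight, w => ∑ i, if w <+: enc i then v i ^ 2 else 0
  | .sign, w => ∑ i, if enc i = w then Real.sign (v i) else 0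

/-- The data structure for a matrix: a tree for each row, and on top a tree over the squared norms of
the rows, whose leaves are the roots of the row trees. -/
def matrixStore {n : ℕ} (Z : Matrix (Fin n) (Fin n) ℝ) : Field → List Bool → ℝ :=
  treeStore (fun p : Fin n × Fin n => bits (Nat.clog 2 n) p.1 ++ bits (Nat.clog 2 n) p.2)
    fun p => Z p.1 p.2

/-- The matrices `A k` stored separately: the data structure for `A k` is found at the addresses that
begin with the bits of `k`. -/
def slicesStore {n m : ℕ} (A : Fin m → Matrix (Fin n) (Fin n) ℝ) (f : Field) (w : List Bool) : ℝ :=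
  ∑ k : Fin m, if bits (Nat.clog 2 m) k <+: w then matrixStore (A k) f (w.drop (Nat.clog 2 m)) else 0

/-- The vectors `(A k i j)_k`, for all `i` and `j`, stored as the rows of a matrix. -/
def fibersStore {n m : ℕ} (A : Fin m → Matrix (Fin n) (Fin n) ℝ) : Field → List Bool → ℝ :=
  treeStore
    (fun p : (Fin n × Fin n) × Fin m =>
      bits (Nat.clog 2 n) p.1.1 ++ bits (Nat.clog 2 n) p.1.2 ++ bits (Nat.clog 2 m) p.2)
    fun p => A p.2 p.1.1 p.1.2

/-- The names of the data structures in the QRAM. -/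
inductive Store : Type
  | Y
  | S
  | Yinv
  | slices
  | fibers

/-- The content of the QRAM when `Y`, `S`, `Y⁻¹` and the tensor of the `A k` are stored in it. -/
def qram {n m : ℕ} (A : Fin m → Matrix (Fin n) (Fin n) ℝ) (S Y : Matrix (Fin n) (Fin n) ℝ) :
    Store × Field → List Bool → ℝ
  | (.Y, f) => matrixStore Y f
  | (.S, f) => matrixStore S f
  | (.Yinv, f) => matrixStore Y⁻¹ f
  | (.slices, f) => slicesStore A f
  | (.fibers, f) => fibersStore A f

/-! ## The matrix of the Newton system -/

/-- The matrix whose row `(i, j)` is `e_i ⊗ Z_j`, with `Z_j` the column `j` of `Z`. -/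
def tildeMatrix {n : ℕ} (Z : Matrix (Fin n) (Fin n) ℝ) :
    Matrix (Fin n × Fin n) (Fin n × Fin n) ℝ := fun p c =>
  (if c.1 = p.1 then 1 else 0) * Z c.2 p.2

/-- The matrix whose row `(i, j)` is `e_j ⊗ Z_i`, with `Z_i` the column `i` of `Z`. -/
def hatMatrix {n : ℕ} (Z : Matrix (Fin n) (Fin n) ℝ) :
    Matrix (Fin n × Fin n) (Fin n × Fin n) ℝ := fun p c =>
  (if c.1 = p.2 then 1 else 0) * Z c.2 p.1

/-- The matrix with rows `vec (A k)`. -/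
def vecMatrix {n m : ℕ} (A : Fin m → Matrix (Fin n) (Fin n) ℝ) :
    Matrix (Fin m) (Fin n × Fin n) ℝ := fun k p => A k p.1 p.2

/-- The order of the rows: `(i, j)` has number `n i + j`, and `k` has number `n² + k`. -/
def rowIndex (n m : ℕ) : (Fin n × Fin n) ⊕ Fin m ≃ Fin (n * n + m) :=
  (Equiv.sumCongr finProdFinEquiv (Equiv.refl (Fin m))).trans finSumFinEquiv

/-- The order of the columns: `k` has number `k`, and `(i, j)` has number `m + n i + j`. -/
def colIndex (n m : ℕ) : Fin m ⊕ (Fin n × Fin n) ≃ Fin (n * n + m) :=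
  ((Equiv.sumCongr (Equiv.refl (Fin m)) finProdFinEquiv).trans finSumFinEquiv).trans
    (finCongr (Nat.add_comm m (n * n)))

/-- The matrix `M₂`. -/
def newtonM2 {n m : ℕ} (A : Fin m → Matrix (Fin n) (Fin n) ℝ) (S Y : Matrix (Fin n) (Fin n) ℝ) :
    Matrix (Fin (n * n + m)) (Fin (n * n + m)) ℝ :=
  Matrix.reindex (rowIndex n m) (colIndex n m)
    (Matrix.fromBlocks (vecMatrix A).transpose (tildeMatrix Y⁻¹ * hatMatrix S) 0 (vecMatrix A))

end QuantumIPM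

end

/-! The circuit is `Rᵀ L`, where `L` and `R` prepare from the numbers `y` of a column and `x` of a row two
states `φ_y` and `ψ_x` with real amplitudes. Its entry at `(x, y)`, with the ancillas equal to `0`, is
the inner product `⟨ψ_x, φ_y⟩`, and this has to be `M₂ x y / ‖M₂‖`.

Both states live on a register for (the code of) a row and one for a column. In `φ_y` the column
register holds `y` and the row register is in a superposition; in `ψ_x` the row register holds `x` and
the column register is in a superposition. So the inner product has only one term, the product of the
amplitude of the row `x` in `φ_y` and the amplitude of the column `y` in `ψ_x`.

The factorisation of the entries is by rows in the top part of `M₂`: the row `x = (i, j)` has the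
amplitude `‖M₂ x‖ / ‖M₂‖` in `φ_y`, and the column `y` has the amplitude `|M₂ x y| / ‖M₂ x‖` in `ψ_x`.
In the bottom part it is by columns: for `y = (i, j)`, the row `k` has the amplitude
`(‖A‖ / ‖M₂‖) |A k i j| / ‖A_{ij}‖` in `φ_y`, where `A_{ij}` is the fiber `(A k i j)ₖ` and `‖A‖²` the
sum of the squares of all entries of all `A k`, and the column `y` has the amplitude `‖A_{ij}‖ / ‖A‖`
in `ψ_k`. All these weights are sums of products of words of the trees of `Y⁻¹`, of `S` and of the
fibers, and so are their sums over the subtrees, because the entry of `tildeMatrix Y⁻¹ * hatMatrix S`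
at `((i, j), (a, b))` is the product of the entries `(j, a)` of `Y⁻¹` and `(i, b)` of `S`. The states
are loaded by one rotation per qubit, down the tree (`load_mul_sqrt`), and the signs are put in by a
single phase (`phase_mul_abs`).

The codes are found from the numbers by long division, where each binary digit is the outcome of one
comparison (`write_sends`), and the number is then erased by the inverse of the circuit which computes
it from the code (`Layout.encode_sends`). For `x` or `y` beyond the size of the matrix a flag makes the
states orthogonal (`Layout.sum_eq_zero_of_le`). There are `O(log N)` gates with angle expressions of
size `O(log² N)`. -/

namespace QuantumIPM

open Function

section Circuits

variable {κ : Type} {q : ℕ}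

/-! ### Circuits as real orthogonal matrices -/

/-- The entry of the one-qubit operator which a gate applies when the register is in the state `b`. -/
noncomputable def Gate.entry (mem : κ → List Bool → ℝ) (g : Gate κ q) (b : Fin q → Bool)
    (i j : Bool) : ℝ :=
  rotationGate (g.x.eval mem (update b g.target false)) (g.y.eval mem (update b g.target false)) i j

/-- `Gate.toMatrix` with real entries. -/
noncomputable def Gate.mat (mem : κ → List Bool → ℝ) (g : Gate κ q) :
    Matrix (Fin q → Bool) (Fin q → Bool) ℝ := fun b' b =>
  if ∀ w, w ≠ g.target → b' w = b w then g.entry mem b (b' g.target) (b g.target) else 0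

/-- `Circuit.toMatrix` with real entries. -/
noncomputable def Circuit.mat (mem : κ → List Bool → ℝ) :
    Circuit κ q → Matrix (Fin q → Bool) (Fin q → Bool) ℝ
  | [] => 1
  | g :: c => Circuit.mat mem c * g.mat mem

variable {mem : κ → List Bool → ℝ}

lemma Gate.toMatrix_eq_map (g : Gate κ q) :
    g.toMatrix mem = (g.mat mem).map ((↑) : ℝ → ℂ) := by
  ext b' b
  simp only [Gate.toMatrix, Gate.mat, Gate.entry, Matrix.map_apply]
  split_ifs <;> simp

lemma Circuit.toMatrix_eq_map (c : Circuit κ q) :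
    Circuit.toMatrix mem c = (Circuit.mat mem c).map ((↑) : ℝ → ℂ) := by
  induction c with
  | nil =>
    rw [Circuit.toMatrix, Circuit.mat]
    ext b' b
    by_cases h : b' = b <;> simp [Matrix.one_apply, h]
  | cons g c ih =>
    rw [Circuit.toMatrix, Circuit.mat, ih, Gate.toMatrix_eq_map]
    exact (Matrix.map_mul (f := Complex.ofRealHom)).symm

lemma rotationGate_transpose (x y : ℝ) : (rotationGate x y).transpose = rotationGate x y := by
  ext i j
  unfold rotationGate
  split_ifs
  · rw [Matrix.transpose_one]
  · cases i <;> cases j <;> simp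

lemma rotationGate_mul_self (x y : ℝ) : rotationGate x y * rotationGate x y = 1 := by
  unfold rotationGate
  split_ifs with h
  · simp
  · have hp : 0 < x ^ 2 + y ^ 2 := by
      by_contra hn
      exact h ⟨by nlinarith [sq_nonneg x, sq_nonneg y], by nlinarith [sq_nonneg x, sq_nonneg y]⟩
    have hs : √(x ^ 2 + y ^ 2) ^ 2 = x ^ 2 + y ^ 2 := Real.sq_sqrt hp.le
    have h0 : √(x ^ 2 + y ^ 2) ≠ 0 := (Real.sqrt_pos.2 hp).ne'
    ext i j
    cases i <;> cases j <;> simp [Matrix.mul_apply] <;> field_simp <;> (try rw [hs]) <;> ring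

lemma rotationGate_zero : rotationGate 0 0 = 1 := by simp [rotationGate]

lemma rotationGate_of_eq_zero {x y : ℝ} (hx : x = 0) (hy : y = 0) (i j : Bool) :
    rotationGate x y i j = if i = j then 1 else 0 := by
  rw [hx, hy, rotationGate_zero, Matrix.one_apply]

lemma rotationGate_zero_one (i j : Bool) :
    rotationGate 0 1 i j = if i = !j then 1 else 0 := by
  cases i <;> cases j <;> simp [rotationGate]

/-- The gate sends `|0⟩` to `x |0⟩ + y |1⟩`, up to normalisation. The equation without division also
holds for `x = y = 0`. -/
lemma rotationGate_mul_sqrt (x y : ℝ) (v : Bool) :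
    rotationGate x y v false * √(x ^ 2 + y ^ 2) = cond v y x := by
  unfold rotationGate
  split_ifs with h
  · cases v <;> simp [h.1, h.2]
  · have hp : 0 < x ^ 2 + y ^ 2 := by
      by_contra hn
      exact h ⟨by nlinarith [sq_nonneg x, sq_nonneg y], by nlinarith [sq_nonneg x, sq_nonneg y]⟩
    have h0 : √(x ^ 2 + y ^ 2) ≠ 0 := (Real.sqrt_pos.2 hp).ne'
    cases v <;> simp <;> field_simp

lemma Gate.entry_update (g : Gate κ q) (b : Fin q → Bool) (v i j : Bool) :
    g.entry mem (update b g.target v) i j = g.entry mem b i j := by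
  simp [Gate.entry]

lemma Gate.mat_eq_sum (g : Gate κ q) (b' b : Fin q → Bool) :
    g.mat mem b' b =
      ∑ v : Bool, if b' = update b g.target v then g.entry mem b v (b g.target) else 0 := by
  have key : (∀ w, w ≠ g.target → b' w = b w) ↔ b' = update b g.target (b' g.target) := by
    rw [eq_update_iff]; simp
  have h2 : ∀ v, b' = update b g.target v → v = b' g.target := by
    rintro v h; rw [h]; simp
  unfold Gate.mat
  by_cases h : b' = update b g.target (b' g.target)
  · rw [if_pos (key.2 h), Finset.sum_eq_single (b' g.target), if_pos h]
    · intro v _ hv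
      exact if_neg fun hh => hv (h2 v hh)
    · simp
  · rw [if_neg (mt key.1 h), Finset.sum_eq_zero]
    intro v _
    exact if_neg fun hh => h (by rwa [← h2 v hh])

lemma Circuit.mat_cons (g : Gate κ q) (c : Circuit κ q) (b' b : Fin q → Bool) :
    Circuit.mat mem (g :: c) b' b =
      ∑ v : Bool, Circuit.mat mem c b' (update b g.target v) * g.entry mem b v (b g.target) := by
  rw [Circuit.mat, Matrix.mul_apply]
  simp_rw [Gate.mat_eq_sum, Finset.mul_sum]
  rw [Finset.sum_comm]
  simp

lemma Gate.mat_transpose (g : Gate κ q) : (g.mat mem).transpose = g.mat mem := by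
  ext b' b
  simp only [Matrix.transpose_apply, Gate.mat]
  by_cases h : ∀ w, w ≠ g.target → b w = b' w
  · rw [if_pos h, if_pos fun w hw => (h w hw).symm]
    have : b = update b' g.target (b g.target) := by rw [eq_update_iff]; simpa using h
    have e : ∀ i j, g.entry mem b i j = g.entry mem b' i j := by
      intro i j; rw [this, Gate.entry_update]
    rw [e, Gate.entry]
    exact congr_fun (congr_fun (rotationGate_transpose _ _) _) _
  · rw [if_neg h, if_neg fun hh => h fun w hw => (hh w hw).symm]

lemma Gate.mat_mul_self (g : Gate κ q) : g.mat mem * g.mat mem = 1 := by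
  have h := fun b' b => Circuit.mat_cons (mem := mem) g [g] b' b
  simp only [Circuit.mat, one_mul] at h
  ext b' b
  rw [h]
  have hb : b = update b g.target (b g.target) := by simp
  have := congr_fun (congr_fun (rotationGate_mul_self
    (g.x.eval mem (update b g.target false)) (g.y.eval mem (update b g.target false)))
    (b' g.target)) (b g.target)
  rw [Matrix.mul_apply] at this
  by_cases hw : ∀ w, w ≠ g.target → b' w = b w
  · have hv : ∀ v, g.mat mem b' (update b g.target v) = g.entry mem b (b' g.target) v := by
      intro v
      rw [Gate.mat, if_pos, Gate.entry_update]
      · simp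
      · intro w h; rw [update_of_ne h]; exact hw w h
    simp_rw [hv]
    refine this.trans ?_
    have hb' : b' = update b g.target (b' g.target) := by rw [eq_update_iff]; simpa using hw
    rw [Matrix.one_apply, Matrix.one_apply]
    congr 1
    rw [eq_iff_iff]
    refine ⟨fun e => by rw [hb', e]; simp, fun e => by rw [e]⟩
  · rw [Matrix.one_apply_ne (fun e => hw fun w _ => by rw [e])]
    refine Finset.sum_eq_zero fun v _ => ?_
    rw [Gate.mat, if_neg, zero_mul]
    intro hh; refine hw fun w h => ?_
    rw [hh w h, update_of_ne h]

lemma Circuit.mat_append (c₁ c₂ : Circuit κ q) :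
    Circuit.mat mem (c₁ ++ c₂) = Circuit.mat mem c₂ * Circuit.mat mem c₁ := by
  induction c₁ with
  | nil => simp [Circuit.mat]
  | cons g c ih => rw [List.cons_append, Circuit.mat, Circuit.mat, ih, Matrix.mul_assoc]

/-- Every gate is a reflection, hence its own inverse, so the reversed circuit is the inverse. -/
lemma Circuit.mat_reverse (c : Circuit κ q) :
    Circuit.mat mem c.reverse = (Circuit.mat mem c).transpose := by
  induction c with
  | nil => simp [Circuit.mat]
  | cons g c ih =>
    rw [List.reverse_cons, Circuit.mat_append, ih, Circuit.mat, Circuit.mat, Circuit.mat,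
      Matrix.one_mul, Matrix.transpose_mul, Gate.mat_transpose]

lemma Circuit.transpose_mat_mul_mat (c : Circuit κ q) :
    (Circuit.mat mem c).transpose * Circuit.mat mem c = 1 := by
  induction c with
  | nil => simp [Circuit.mat]
  | cons g c ih =>
    rw [Circuit.mat, Matrix.transpose_mul, Gate.mat_transpose, Matrix.mul_assoc,
      ← Matrix.mul_assoc _ (Circuit.mat mem c), ih, Matrix.one_mul, Gate.mat_mul_self]

lemma Circuit.toMatrix_mem_unitaryGroup (c : Circuit κ q) :
    Circuit.toMatrix mem c ∈ Matrix.unitaryGroup (Fin q → Bool) ℂ := by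
  rw [Matrix.mem_unitaryGroup_iff', Circuit.toMatrix_eq_map]
  have h := congr_arg (fun M => M.map Complex.ofRealHom)
    (Circuit.transpose_mat_mul_mat (mem := mem) c)
  simp only [Matrix.map_mul] at h
  convert h using 1
  · congr 1
    ext b' b
    simp [Matrix.star_apply]
  · ext b' b
    by_cases hb : b' = b <;> simp [Matrix.one_apply, hb]

/-! ### Registers and classical computations -/

/-- The qubits on which a circuit acts. -/
def Circuit.targets (c : Circuit κ q) : List (Fin q) := c.map Gate.target

lemma Circuit.mat_eq_zero {c : Circuit κ q} {w : Fin q} (hw : w ∉ Circuit.targets c)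
    {b' b : Fin q → Bool} (hb : b' w ≠ b w) : Circuit.mat mem c b' b = 0 := by
  induction c generalizing b with
  | nil =>
    rw [Circuit.mat, Matrix.one_apply_ne]
    rintro rfl; exact hb rfl
  | cons g c ih =>
    simp only [Circuit.targets, List.map_cons, List.mem_cons, not_or] at hw
    rw [Circuit.mat_cons, Finset.sum_eq_zero]
    intro v _
    rw [ih hw.2, zero_mul]
    rwa [update_of_ne hw.1]

/-- Write the bits `l` to the qubits `R`. -/
def setBits (b : Fin q → Bool) : List (Fin q) → List Bool → Fin q → Bool
  | t :: R, v :: l => setBits (update b t v) R l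
  | _, _ => b

lemma setBits_of_notMem {R : List (Fin q)} {w : Fin q} (hw : w ∉ R) (b : Fin q → Bool)
    (l : List Bool) : setBits b R l w = b w := by
  induction R generalizing b l with
  | nil => simp [setBits]
  | cons t R ih =>
    cases l with
    | nil => simp [setBits]
    | cons v l =>
      simp only [List.mem_cons, not_or] at hw
      rw [setBits, ih hw.2, update_of_ne hw.1]

lemma map_setBits {R : List (Fin q)} (hR : R.Nodup) (b : Fin q → Bool) {l : List Bool}
    (hl : l.length = R.length) : R.map (setBits b R l) = l := by
  induction R generalizing b l with
  | nil => simpa [eq_comm] using hl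
  | cons t R ih =>
    cases l with
    | nil => simp at hl
    | cons v l =>
      rw [List.nodup_cons] at hR
      rw [List.map_cons, setBits, ih hR.2 _ (by simpa using hl), setBits_of_notMem hR.1]
      simp

lemma map_setBits_of_disjoint {R T : List (Fin q)} (hR : T.Disjoint R) (b : Fin q → Bool)
    (l : List Bool) : T.map (setBits b R l) = T.map b :=
  List.map_congr_left fun _ hw => setBits_of_notMem (hR hw) b l

/-- If two parts of a circuit act on different qubits, then only one intermediate state contributes
to a given entry of its matrix. -/
lemma Circuit.mat_append_apply {c₁ c₂ : Circuit κ q}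
    (hd : (Circuit.targets c₁).Disjoint (Circuit.targets c₂)) {b' b₁ b : Fin q → Bool}
    (h₁ : ∀ w ∈ Circuit.targets c₁, b₁ w = b' w) (h₂ : ∀ w ∉ Circuit.targets c₁, b₁ w = b w) :
    Circuit.mat mem (c₁ ++ c₂) b' b = Circuit.mat mem c₂ b' b₁ * Circuit.mat mem c₁ b₁ b := by
  rw [Circuit.mat_append, Matrix.mul_apply, Finset.sum_eq_single b₁]
  · intro b₂ _ hb
    obtain ⟨w, hw⟩ := Function.ne_iff.1 hb
    by_cases hm : w ∈ Circuit.targets c₁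
    · rw [Circuit.mat_eq_zero (c := c₂) (w := w) (fun h => hd hm h), zero_mul]
      rw [← h₁ w hm]; exact hw.symm
    · rw [Circuit.mat_eq_zero (c := c₁) hm, mul_zero]
      rwa [← h₂ w hm]
  · simp

/-- The circuit takes the basis state `b` to the basis state `b'`. -/
def Circuit.Sends (mem : κ → List Bool → ℝ) (c : Circuit κ q) (b b' : Fin q → Bool) : Prop :=
  Matrix.mulVec (Circuit.mat mem c) (Pi.single b 1) = Pi.single b' 1

lemma Circuit.Sends.apply {c : Circuit κ q} {b b' : Fin q → Bool} (h : Circuit.Sends mem c b b')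
    (b'' : Fin q → Bool) : Circuit.mat mem c b'' b = if b'' = b' then 1 else 0 := by
  have := congr_fun h b''
  rw [Matrix.mulVec_single_one] at this
  simpa [Pi.single_apply] using this

lemma Circuit.Sends.nil (b : Fin q → Bool) : Circuit.Sends mem [] b b := by
  rw [Circuit.Sends, Circuit.mat, Matrix.one_mulVec]

lemma Circuit.Sends.append {c₁ c₂ : Circuit κ q} {b b₁ b₂ : Fin q → Bool}
    (h₁ : Circuit.Sends mem c₁ b b₁) (h₂ : Circuit.Sends mem c₂ b₁ b₂) :
    Circuit.Sends mem (c₁ ++ c₂) b b₂ := by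
  rw [Circuit.Sends, Circuit.mat_append, ← Matrix.mulVec_mulVec, h₁, h₂]

lemma Circuit.Sends.mat_append {c₁ : Circuit κ q} {b b₁ : Fin q → Bool}
    (h₁ : Circuit.Sends mem c₁ b b₁) (c₂ : Circuit κ q) (b₂ : Fin q → Bool) :
    Circuit.mat mem (c₁ ++ c₂) b₂ b = Circuit.mat mem c₂ b₂ b₁ := by
  rw [Circuit.mat_append, Matrix.mul_apply, Finset.sum_eq_single b₁]
  · rw [h₁.apply, if_pos rfl, mul_one]
  · intro b' _ hb
    rw [h₁.apply, if_neg hb, mul_zero]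
  · simp

lemma Circuit.Sends.reverse {c : Circuit κ q} {b b' : Fin q → Bool}
    (h : Circuit.Sends mem c b b') : Circuit.Sends mem c.reverse b' b := by
  rw [Circuit.Sends, Circuit.mat_reverse, ← h, Matrix.mulVec_mulVec,
    Circuit.transpose_mat_mul_mat, Matrix.one_mulVec]

lemma Circuit.Sends.cons {g : Gate κ q} {c : Circuit κ q} {b b' : Fin q → Bool} {v : Bool}
    (hg : ∀ i, g.entry mem b i (b g.target) = if i = v then 1 else 0)
    (hc : Circuit.Sends mem c (update b g.target v) b') : Circuit.Sends mem (g :: c) b b' := by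
  refine Circuit.Sends.append (c₁ := [g]) (b₁ := update b g.target v) ?_ hc
  rw [Circuit.Sends, Matrix.mulVec_single_one]
  ext b''
  simp [Matrix.col_apply, Circuit.mat, Gate.mat_eq_sum, hg, Pi.single_apply]
  cases v <;> simp

end Circuits

section Registers

variable {κ : Type} {q : ℕ} {mem : κ → List Bool → ℝ}

/-! ### Binary expansions -/

/-- The number with the binary digits `l`, most significant digit first. -/
def bitsVal : List Bool → ℕ
  | [] => 0
  | v :: l => v.toNat * 2 ^ l.length + bitsVal l

lemma length_bits (s i : ℕ) : (bits s i).length = s := by simp [bits]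

lemma bits_zero (s : ℕ) : bits s 0 = List.replicate s false := by
  simp [bits]

lemma bits_succ (s i : ℕ) : bits (s + 1) i = i.testBit s :: bits s i := by
  simp only [bits, List.ofFn_succ]
  congr 2
  funext j
  congr 1
  simp [Fin.val_rev]

lemma bitsVal_append (l₁ l₂ : List Bool) :
    bitsVal (l₁ ++ l₂) = bitsVal l₁ * 2 ^ l₂.length + bitsVal l₂ := by
  induction l₁ with
  | nil => simp [bitsVal]
  | cons v l ih =>
    simp only [List.cons_append, bitsVal, ih, List.length_append, pow_add]
    ring

lemma bitsVal_lt (l : List Bool) : bitsVal l < 2 ^ l.length := by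
  induction l with
  | nil => simp [bitsVal]
  | cons v l ih =>
    rw [bitsVal, List.length_cons, pow_succ]
    cases v <;> simp <;> omega

lemma bits_bitsVal (l : List Bool) : bits l.length (bitsVal l) = l := by
  induction l with
  | nil => simp [bits]
  | cons v l ih =>
    rw [List.length_cons, bits_succ]
    have hl := bitsVal_lt l
    congr 1
    · rw [bitsVal, Nat.testBit_eq_decide_div_mod_eq, mul_comm, Nat.mul_add_div (by positivity),
        Nat.div_eq_of_lt hl]
      cases v <;> simp
    · conv_rhs => rw [← ih]
      simp only [bits, bitsVal]
      congr 1
      funext j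
      rw [mul_comm, Nat.testBit_two_pow_mul_add _ hl, if_pos (by omega)]

lemma bits_inj {s i j : ℕ} (hi : i < 2 ^ s) (hj : j < 2 ^ s) (h : bits s i = bits s j) :
    i = j := by
  refine Nat.eq_of_testBit_eq fun k => ?_
  by_cases hk : k < s
  · rw [bits, bits, List.ofFn_inj] at h
    simpa [Fin.val_rev, Nat.sub_sub_self (Nat.succ_le_of_lt hk),
      show s - (s - (k + 1) + 1) = k by omega] using congr_fun h (Fin.rev ⟨k, hk⟩)
  · have := Nat.pow_le_pow_right (n := 2) (by norm_num) (not_lt.1 hk)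
    rw [Nat.testBit_lt_two_pow (by omega), Nat.testBit_lt_two_pow (by omega)]

lemma bitsVal_bits {s i : ℕ} (hi : i < 2 ^ s) : bitsVal (bits s i) = i := by
  have h := bits_bitsVal (bits s i)
  have h' := bitsVal_lt (bits s i)
  rw [length_bits] at h h'
  exact bits_inj h' hi h

lemma ofFn_eq_bits {s : ℕ} (x : Fin s → Bool) :
    List.ofFn x = bits s (Nat.ofBits fun i => x i.rev) := by
  rw [bits, List.ofFn_inj]
  funext j
  rw [Nat.testBit_ofBits_lt _ _ (Fin.is_lt _)]
  exact congr_arg x (Fin.rev_rev j).symm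

/-! ### Writing the binary digits of a computed number -/

/-- The number held by the qubits `R`, most significant digit first. -/
def valExpr : List (Fin q) → AngleExpr κ q
  | [] => .const 0
  | t :: R => .add (.mul (.bit t) (.const ((2 ^ R.length : ℕ) : ℤ))) (valExpr R)

lemma eval_valExpr (R : List (Fin q)) (b : Fin q → Bool) :
    (valExpr R).eval mem b = (bitsVal (R.map b) : ℝ) := by
  induction R with
  | nil => simp [valExpr, AngleExpr.eval, bitsVal]
  | cons t R ih =>
    simp only [valExpr, AngleExpr.eval, ih, List.map_cons, bitsVal, List.length_map]
    cases b t <;> simp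

/-- Write the binary digits of `⌊V / c⌋` to the qubits of the last argument, given that the digits in
front of them have been written to the qubits `R`. A digit is found by comparing `V` with `c` times
the number which has the digits written so far and a one as the next digit. -/
def writeAux (c : ℕ) (V : AngleExpr κ q) : List (Fin q) → List (Fin q) → Circuit κ q
  | _, [] => []
  | R, t :: T =>
    ⟨t, .const 0, .le (.mul (.const c) (.add (.mul (.const ((2 ^ (T.length + 1) : ℕ) : ℤ)) (valExpr R))
      (.const ((2 ^ T.length : ℕ) : ℤ)))) V⟩ :: writeAux c V (R ++ [t]) T

/-- Write the binary digits of `⌊V / c⌋` to the qubits `T`. -/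
def write (c : ℕ) (V : AngleExpr κ q) (T : List (Fin q)) : Circuit κ q := writeAux c V [] T

lemma targets_writeAux (c : ℕ) (V : AngleExpr κ q) (R T : List (Fin q)) :
    Circuit.targets (writeAux c V R T) = T := by
  induction T generalizing R with
  | nil => rfl
  | cons t T ih => exact congr_arg (t :: ·) (ih _)

lemma targets_write (c : ℕ) (V : AngleExpr κ q) (T : List (Fin q)) :
    Circuit.targets (write c V T) = T := targets_writeAux _ _ _ _

/-- The digits of `v / c` are found in turn: with `u` the number of the digits written so far and `l`
digits left after the next one, the next digit is `1` if and only if `c (2u + 1) 2 ^ l ≤ v`. -/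
lemma writeAux_sends {c : ℕ} (hc : 0 < c) {V : AngleExpr κ q} {v : ℕ} {R T : List (Fin q)}
    (hT : (R ++ T).Nodup) {b : Fin q → Bool} (hb : ∀ w ∈ T, b w = false)
    (hV : ∀ b', (∀ w ∉ T, b' w = b w) → V.eval mem b' = v)
    (hR : bitsVal (R.map b) = v / c / 2 ^ T.length) :
    Circuit.Sends mem (writeAux c V R T) b (setBits b T (bits T.length (v / c))) := by
  induction T generalizing R b with
  | nil => simpa [writeAux, setBits] using Circuit.Sends.nil b
  | cons t T ih =>
    have htR : t ∉ R := by
      intro h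
      exact (List.nodup_append.1 hT).2.2 t h t (by simp) rfl
    have htT : t ∉ T := (List.nodup_cons.1 (List.nodup_append.1 hT).2.1).1
    have hbt : update b t false = b := by rw [← hb t (by simp)]; simp
    have hmap : ∀ u, R.map (update b t u) = R.map b := fun u =>
      List.map_congr_left fun w hw => update_of_ne (ne_of_mem_of_not_mem hw htR) _ _
    set n := v / c with hn
    have hdig : n / 2 ^ T.length = 2 * bitsVal (R.map b) + (n.testBit T.length).toNat := by
      rw [hR, List.length_cons, pow_succ, ← Nat.div_div_eq_div_mul, Nat.testBit_eq_decide_div_mod_eq]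
      have := Nat.div_add_mod (n / 2 ^ T.length) 2
      rcases Nat.mod_two_eq_zero_or_one (n / 2 ^ T.length) with h | h <;> simp [h] <;> omega
    rw [List.length_cons, bits_succ, setBits, writeAux]
    refine Circuit.Sends.cons (v := n.testBit T.length) ?_ (ih ?_ ?_ ?_ ?_)
    · intro i
      have hcmp : c * (2 ^ (T.length + 1) * bitsVal (R.map b) + 2 ^ T.length) ≤ v ↔
          n.testBit T.length = true := by
        rw [mul_comm, ← Nat.le_div_iff_mul_le hc, ← hn,
          show 2 ^ (T.length + 1) * bitsVal (R.map b) + 2 ^ T.length =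
            (2 * bitsVal (R.map b) + 1) * 2 ^ T.length by ring,
          ← Nat.le_div_iff_mul_le (by positivity), hdig]
        cases n.testBit T.length <;> simp
      have hx : AngleExpr.eval mem b (.le (.mul (.const c) (.add (.mul (.const
          ((2 ^ (T.length + 1) : ℕ) : ℤ)) (valExpr R)) (.const ((2 ^ T.length : ℕ) : ℤ)))) V) =
          if n.testBit T.length = true then 1 else 0 := by
        simp only [AngleExpr.eval, eval_valExpr, hV b fun _ _ => rfl]
        have : ((c : ℤ) : ℝ) * ((((2 ^ (T.length + 1) : ℕ) : ℤ) : ℝ) * (bitsVal (R.map b) : ℝ) +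
            (((2 ^ T.length : ℕ) : ℤ) : ℝ)) ≤ (v : ℝ) ↔ n.testBit T.length = true := by
          rw [← hcmp]
          exact_mod_cast Iff.rfl
        simp only [this]
      rw [Gate.entry, hbt, hx, hb t (by simp)]
      simp only [AngleExpr.eval, Int.cast_zero]
      cases n.testBit T.length
      · simp only [Bool.false_eq_true, if_false]
        exact rotationGate_of_eq_zero rfl rfl _ _
      · simp only [if_true]
        exact rotationGate_zero_one _ _
    · simpa using hT
    · intro w hw
      rw [update_of_ne (ne_of_mem_of_not_mem hw htT)]
      exact hb w (by simp [hw])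
    · intro b' hb'
      refine hV b' fun w hw => ?_
      simp only [List.mem_cons, not_or] at hw
      rw [hb' w hw.2, update_of_ne hw.1]
    · rw [List.map_append, bitsVal_append, hmap, hdig]
      simp [bitsVal, mul_comm]

lemma write_sends {c : ℕ} (hc : 0 < c) {V : AngleExpr κ q} {v : ℕ} {T : List (Fin q)}
    (hT : T.Nodup) {b : Fin q → Bool} (hb : ∀ w ∈ T, b w = false)
    (hV : ∀ b', (∀ w ∉ T, b' w = b w) → V.eval mem b' = v) (hv : v / c < 2 ^ T.length) :
    Circuit.Sends mem (write c V T) b (setBits b T (bits T.length (v / c))) :=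
  writeAux_sends hc (by simpa) hb hV (by simp [bitsVal, Nat.div_eq_of_lt hv])

/-! ### Loading a state from a binary tree -/

/-- Given that the qubits `R` hold the name of a node, go down the tree with the weights `W`: one qubit
after the other is rotated, so that the amplitudes of the two children of a node are in proportion to
the square roots of their weights. -/
def loadAux (W : List (Fin q ⊕ Bool) → AngleExpr κ q) : List (Fin q) → List (Fin q) → Circuit κ q
  | _, [] => []
  | R, t :: T =>
    ⟨t, .sqrt (W (R.map Sum.inl ++ [Sum.inr false])), .sqrt (W (R.map Sum.inl ++ [Sum.inr true]))⟩ ::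
      loadAux W (R ++ [t]) T

/-- Load the state whose amplitudes are the square roots of the weights `W` of the leaves, up to
normalisation, to the qubits `T`. -/
def load (W : List (Fin q ⊕ Bool) → AngleExpr κ q) (T : List (Fin q)) : Circuit κ q := loadAux W [] T

lemma targets_loadAux (W : List (Fin q ⊕ Bool) → AngleExpr κ q) (R T : List (Fin q)) :
    Circuit.targets (loadAux W R T) = T := by
  induction T generalizing R with
  | nil => rfl
  | cons t T ih => exact congr_arg (t :: ·) (ih _)

lemma targets_load (W : List (Fin q ⊕ Bool) → AngleExpr κ q) (T : List (Fin q)) :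
    Circuit.targets (load W T) = T := targets_loadAux _ _ _

/-- A gate whose target is not used later contributes one factor to a given entry. -/
lemma Circuit.mat_cons_of_notMem {g : Gate κ q} {c : Circuit κ q} (hg : g.target ∉ Circuit.targets c)
    (b' b : Fin q → Bool) :
    Circuit.mat mem (g :: c) b' b = Circuit.mat mem c b' (update b g.target (b' g.target)) *
      g.entry mem b (b' g.target) (b g.target) := by
  rw [Circuit.mat_cons, Finset.sum_eq_single (b' g.target)]
  · intro v _ hv
    rw [Circuit.mat_eq_zero hg, zero_mul]
    simpa using hv.symm
  · simp

lemma loadAux_mul_sqrt {W : List (Fin q ⊕ Bool) → AngleExpr κ q} {ω : List Bool → ℝ}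
    {R T : List (Fin q)} (hT : (R ++ T).Nodup) {b : Fin q → Bool} (hb : ∀ w ∈ T, b w = false)
    (hW : ∀ b', (∀ w ∉ T, b' w = b w) → ∀ a, (W a).eval mem b' = ω (a.map (Sum.elim b' id)))
    (h0 : ∀ p, 0 ≤ ω p)
    (hadd : ∀ p, p.length < R.length + T.length → ω p = ω (p ++ [false]) + ω (p ++ [true]))
    {l : List Bool} (hl : l.length = T.length) :
    Circuit.mat mem (loadAux W R T) (setBits b T l) b * √(ω (R.map b)) = √(ω (R.map b ++ l)) := by
  induction T generalizing R b l with
  | nil =>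
    have : l = [] := by simpa using hl
    simp [loadAux, Circuit.mat, setBits, this]
  | cons t T ih =>
    have htR : t ∉ R := by
      intro h
      exact (List.nodup_append.1 hT).2.2 t h t (by simp) rfl
    have htT : t ∉ T := (List.nodup_cons.1 (List.nodup_append.1 hT).2.1).1
    have hbt : update b t false = b := by rw [← hb t (by simp)]; simp
    have hmap : ∀ u, R.map (update b t u) = R.map b := fun u =>
      List.map_congr_left fun w hw => update_of_ne (ne_of_mem_of_not_mem hw htR) _ _
    obtain _ | ⟨u, l⟩ := l
    · simp at hl
    have hu : setBits b (t :: T) (u :: l) t = u := by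
      rw [setBits, setBits_of_notMem htT]; simp
    have hstep := ih (R := R ++ [t]) (b := update b t u) (l := l) (by simpa using hT) ?_ ?_ ?_
      (by simpa using hl)
    rotate_left
    · intro w hw
      rw [update_of_ne (ne_of_mem_of_not_mem hw htT)]
      exact hb w (by simp [hw])
    · intro b' hb'
      refine hW b' fun w hw => ?_
      simp only [List.mem_cons, not_or] at hw
      rw [hb' w hw.2, update_of_ne hw.1]
    · intro p hp
      refine hadd p ?_
      simp only [List.length_append, List.length_cons, List.length_nil] at hp ⊢
      omega
    rw [loadAux, Circuit.mat_cons_of_notMem (by rwa [targets_loadAux])]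
    have hev : ∀ v, (W (R.map Sum.inl ++ [Sum.inr v])).eval mem b = ω (R.map b ++ [v]) := by
      intro v
      rw [hW b fun _ _ => rfl]
      congr 1
      simp [Function.comp_def]
    have hrot := rotationGate_mul_sqrt (√(ω (R.map b ++ [false]))) (√(ω (R.map b ++ [true]))) u
    rw [Real.sq_sqrt (h0 _), Real.sq_sqrt (h0 _), ← hadd _ (by simp)] at hrot
    have hcond : (cond u (√(ω (R.map b ++ [true]))) (√(ω (R.map b ++ [false])))) =
        √(ω (R.map b ++ [u])) := by cases u <;> rfl
    simp only [hu, Gate.entry, hbt, hb t (by simp), AngleExpr.eval, hev]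
    rw [mul_assoc, hrot, hcond, setBits]
    simpa [hmap] using hstep

/-- The amplitude of a leaf is `√(ω l / ω [])`, stated without division: if the weight of the root is
zero, then so are the weights of the leaves. -/
lemma load_mul_sqrt {W : List (Fin q ⊕ Bool) → AngleExpr κ q} {ω : List Bool → ℝ}
    {T : List (Fin q)} (hT : T.Nodup) {b : Fin q → Bool} (hb : ∀ w ∈ T, b w = false)
    (hW : ∀ b', (∀ w ∉ T, b' w = b w) → ∀ a, (W a).eval mem b' = ω (a.map (Sum.elim b' id)))
    (h0 : ∀ p, 0 ≤ ω p)
    (hadd : ∀ p, p.length < T.length → ω p = ω (p ++ [false]) + ω (p ++ [true]))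
    {l : List Bool} (hl : l.length = T.length) :
    Circuit.mat mem (load W T) (setBits b T l) b * √(ω []) = √(ω l) :=
  loadAux_mul_sqrt (R := []) (by simpa) hb hW h0 (by simpa using hadd) hl

lemma loadAux_sends_self {W : List (Fin q ⊕ Bool) → AngleExpr κ q} {R T : List (Fin q)}
    {b : Fin q → Bool} (hW : ∀ b', (∀ w ∉ T, b' w = b w) → ∀ a, (W a).eval mem b' = 0) :
    Circuit.Sends mem (loadAux W R T) b b := by
  induction T generalizing R with
  | nil => exact Circuit.Sends.nil b
  | cons t T ih =>
    refine Circuit.Sends.cons (v := b t) ?_ ?_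
    · intro i
      have h : ∀ a, (W a).eval mem (update b t false) = 0 := hW _ fun w hw => by
        simp only [List.mem_cons, not_or] at hw
        rw [update_of_ne hw.1]
      exact rotationGate_of_eq_zero (by simp [AngleExpr.eval, h]) (by simp [AngleExpr.eval, h]) _ _
    · rw [update_eq_self]
      exact ih fun b' hb' => hW b' fun w hw => hb' w fun h => hw (by simp [h])

/-- Loading with zero weights does nothing. -/
lemma load_sends_self {W : List (Fin q ⊕ Bool) → AngleExpr κ q} {T : List (Fin q)}
    {b : Fin q → Bool} (hW : ∀ b', (∀ w ∉ T, b' w = b w) → ∀ a, (W a).eval mem b' = 0) :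
    Circuit.Sends mem (load W T) b b := loadAux_sends_self hW

/-! ### Branching and phases -/

/-- Rotate the qubits `T`, so that the amplitudes of `0` and `1` are in proportion to the square
roots of `e₀` and `e₁`. -/
def branch (e₀ e₁ : AngleExpr κ q) (T : List (Fin q)) : Circuit κ q :=
  T.map fun t => ⟨t, .sqrt e₀, .sqrt e₁⟩

/-- Multiply by the sign of `e` if the qubits `T` are `0` and `e` is not zero. -/
def phase (e : AngleExpr κ q) (T : List (Fin q)) : Circuit κ q :=
  T.map fun t => ⟨t, e, .const 0⟩

lemma targets_branch (e₀ e₁ : AngleExpr κ q) (T : List (Fin q)) :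
    Circuit.targets (branch e₀ e₁ T) = T := by
  simp [branch, Circuit.targets, Function.comp_def]

lemma targets_phase (e : AngleExpr κ q) (T : List (Fin q)) :
    Circuit.targets (phase e T) = T := by
  simp [phase, Circuit.targets, Function.comp_def]

lemma Circuit.mat_singleton (g : Gate κ q) (b : Fin q → Bool) (v : Bool) :
    Circuit.mat mem [g] (update b g.target v) b = g.entry mem b v (b g.target) := by
  rw [Circuit.mat_cons_of_notMem (by simp [Circuit.targets]), update_self, Circuit.mat,
    Matrix.one_apply_eq, one_mul]

lemma branch_mul_sqrt {e₀ e₁ : AngleExpr κ q} {T : List (Fin q)} (hT : T.length = 1)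
    {b : Fin q → Bool} (hb : ∀ w ∈ T, b w = false) {ω₀ ω₁ : ℝ} (h₀ : 0 ≤ ω₀) (h₁ : 0 ≤ ω₁)
    (he₀ : e₀.eval mem b = ω₀) (he₁ : e₁.eval mem b = ω₁) (v : Bool) :
    Circuit.mat mem (branch e₀ e₁ T) (setBits b T [v]) b * √(ω₀ + ω₁) = √(cond v ω₁ ω₀) := by
  obtain ⟨t, rfl⟩ := List.length_eq_one_iff.1 hT
  have hbt : update b t false = b := by rw [← hb t (by simp)]; simp
  have h := rotationGate_mul_sqrt (√ω₀) (√ω₁) v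
  rw [Real.sq_sqrt h₀, Real.sq_sqrt h₁] at h
  simp only [branch, List.map_cons, List.map_nil, setBits]
  rw [Circuit.mat_singleton ⟨t, .sqrt e₀, .sqrt e₁⟩]
  simp only [Gate.entry, hbt, hb t (by simp), AngleExpr.eval, he₀, he₁, h]
  cases v <;> rfl

lemma branch_sends_self {e₀ e₁ : AngleExpr κ q} {T : List (Fin q)} (hT : T.length = 1)
    {b : Fin q → Bool} (hb : ∀ w ∈ T, b w = false)
    (he₀ : e₀.eval mem b = 0) (he₁ : e₁.eval mem b = 0) :
    Circuit.Sends mem (branch e₀ e₁ T) b b := by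
  obtain ⟨t, rfl⟩ := List.length_eq_one_iff.1 hT
  have hbt : update b t false = b := by rw [← hb t (by simp)]; simp
  refine Circuit.Sends.cons (v := b t) (fun i => ?_) (by simpa using Circuit.Sends.nil b)
  refine rotationGate_of_eq_zero ?_ ?_ _ _ <;> simp [AngleExpr.eval, hbt, he₀, he₁]

lemma phase_mul_abs {e : AngleExpr κ q} {T : List (Fin q)} (hT : T.length = 1)
    {b : Fin q → Bool} (hb : ∀ w ∈ T, b w = false) {r : ℝ}
    (he : e.eval mem b = Real.sign r) :
    Circuit.mat mem (phase e T) b b * |r| = r := by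
  obtain ⟨t, rfl⟩ := List.length_eq_one_iff.1 hT
  have hbt : update b t false = b := by rw [← hb t (by simp)]; simp
  have h := rotationGate_mul_sqrt (Real.sign r) 0 false
  have h' := Circuit.mat_singleton (mem := mem) ⟨t, e, .const 0⟩ b false
  simp only [hbt] at h'
  simp only [phase, List.map_cons, List.map_nil, h']
  simp only [Gate.entry, hbt, hb t (by simp), AngleExpr.eval, he, Int.cast_zero]
  rcases Real.sign_apply_eq r with hr | hr | hr
  · rw [hr] at h ⊢
    have : r < 0 := by
      by_contra hn
      rcases (not_lt.1 hn).eq_or_lt with h0 | h0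
      · rw [← h0, Real.sign_zero] at hr; norm_num at hr
      · rw [Real.sign_of_pos h0] at hr; norm_num at hr
    rw [abs_of_neg this]
    norm_num at h
    rw [h]; ring
  · rw [Real.sign_eq_zero_iff.1 hr]; simp
  · rw [hr] at h ⊢
    have : 0 < r := by
      by_contra hn
      rcases (not_lt.1 hn).eq_or_lt with h0 | h0
      · rw [h0, Real.sign_zero] at hr; norm_num at hr
      · rw [Real.sign_of_neg h0] at hr; norm_num at hr
    rw [abs_of_pos this]
    norm_num at h
    rw [h]; ring

end Registers

/-! ### The layout of the qubits -/

/-- The registers of the circuit: the `data` on which `M₂` is encoded, and, among the ancillas, error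
flags for data which are not the number of a row or a column, a qubit for phases, and codes for a row
(argument `false`) and a column (argument `true`). A code consists of a flag, which is `0` for a pair
`(i, j)` and `1` for an index `k`, and of binary expansions of `i`, `j` and `k`. -/
inductive Reg : Type
  | data
  | errRow
  | errCol
  | sgn
  | flag (c : Bool)
  | fst (c : Bool)
  | snd (c : Bool)
  | idx (c : Bool)
  deriving DecidableEq, Fintype

/-- The number of qubits of a register. -/
def Reg.width (n m : ℕ) : Reg → ℕ
  | .data => Nat.clog 2 (n * n + m)
  | .errRow | .errCol | .sgn | .flag _ => 1
  | .fst _ | .snd _ => Nat.clog 2 n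
  | .idx _ => Nat.clog 2 m

/-- A partition of `q` qubits into the registers. The first qubit of a register is the most
significant one. -/
structure Layout (n m q : ℕ) where
  reg : Reg → List (Fin q)
  length_reg : ∀ r, (reg r).length = r.width n m
  nodup_reg : ∀ r, (reg r).Nodup
  disjoint_reg : ∀ r r', r ≠ r' → (reg r).Disjoint (reg r')
  exists_mem_reg : ∀ w, ∃ r, w ∈ reg r

lemma one_le_clog {n m : ℕ} (hn : 0 < n) (hm : 0 < m) : 1 ≤ Nat.clog 2 (n * n + m) := by
  have : 0 < n * n := by positivity
  exact Nat.clog_pos (by norm_num) (by omega)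

lemma Reg.width_le {n m : ℕ} (hn : 0 < n) (hm : 0 < m) (r : Reg) :
    r.width n m ≤ Nat.clog 2 (n * n + m) := by
  have h1 := one_le_clog hn hm
  have h2 : n ≤ n * n := Nat.le_mul_of_pos_left n hn
  cases r <;> simp only [Reg.width, le_refl] <;>
    first | exact h1 | exact Nat.clog_mono_right 2 (by omega)

lemma exists_layout {n m : ℕ} (hn : 0 < n) (hm : 0 < m) :
    ∃ t ≤ 11 * Nat.clog 2 (n * n + m), ∃ L : Layout n m (t + Nat.clog 2 (n * n + m)),
      L.reg .data = List.ofFn (Fin.natAdd t) := by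
  classical
  let X := Σ r : {r : Reg // r ≠ .data}, Fin (r.1.width n m)
  let e : X ≃ Fin (Fintype.card X) := Fintype.equivFin X
  refine ⟨Fintype.card X, ?_, ⟨fun r => if h : r = .data then
      List.ofFn fun j => Fin.natAdd (Fintype.card X) j
    else List.ofFn fun j => Fin.castAdd (Nat.clog 2 (n * n + m)) (e ⟨⟨r, h⟩, j⟩), ?_, ?_, ?_, ?_⟩, ?_⟩
  · rw [Fintype.card_sigma]
    refine (Finset.sum_le_card_nsmul _ _ (Nat.clog 2 (n * n + m)) fun r _ => ?_).trans_eq ?_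
    · rw [Fintype.card_fin]; exact r.1.width_le hn hm
    · rw [Finset.card_univ, Fintype.card_subtype_compl, smul_eq_mul, Fintype.card_subtype_eq]
      rfl
  · intro r
    by_cases h : r = .data
    · subst h; simp [Reg.width]
    · simp [h]
  · intro r
    by_cases h : r = .data
    · simp only [h, dite_true]
      exact List.nodup_ofFn.2 (Fin.natAdd_injective _ _)
    · simp only [h, dite_false]
      refine List.nodup_ofFn.2 fun i j hij => ?_
      exact eq_of_heq (Sigma.mk.inj (e.injective (Fin.castAdd_injective _ _ hij))).2
  · intro r r' hr w hw hw'
    by_cases h : r = .data <;> by_cases h' : r' = .data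
    · exact hr (h.trans h'.symm)
    all_goals
      simp only [h, h', dite_true, dite_false, List.mem_ofFn] at hw hw'
      obtain ⟨i, rfl⟩ := hw
      obtain ⟨j, hj⟩ := hw'
    · have := congr_arg Fin.val hj
      simp only [Fin.val_castAdd, Fin.val_natAdd] at this
      omega
    · have := congr_arg Fin.val hj
      simp only [Fin.val_castAdd, Fin.val_natAdd] at this
      omega
    · have := congr_arg (fun x : X => x.1.1) (e.injective (Fin.castAdd_injective _ _ hj))
      exact hr this.symm
  · intro w
    induction w using Fin.addCases with
    | left i =>
      refine ⟨(e.symm i).1.1, ?_⟩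
      rw [dif_neg (e.symm i).1.2, List.mem_ofFn]
      exact ⟨(e.symm i).2, congr_arg _ (e.apply_symm_apply i)⟩
    | right j => exact ⟨.data, by simp⟩
  · simp

namespace Layout

variable {n m q : ℕ} (L : Layout n m q)

/-- The content of a register. -/
def get (b : Fin q → Bool) (r : Reg) : List Bool := (L.reg r).map b

/-- The basis state in which each register `r` holds the number `v r`. -/
noncomputable def state (v : Reg → ℕ) : Fin q → Bool := fun w =>
  -- the register to which the qubit belongs
  let r := (L.exists_mem_reg w).choose
  (bits (r.width n m) (v r)).getD ((L.reg r).idxOf w) false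

lemma ext {b b' : Fin q → Bool} (h : ∀ r, L.get b r = L.get b' r) : b = b' := by
  funext w
  obtain ⟨r, hr⟩ := L.exists_mem_reg w
  exact List.map_inj_left.1 (h r) w hr

lemma eq_of_get_eq {b b' : Fin q → Bool} {r : Reg} (h : L.get b r = L.get b' r) {w : Fin q}
    (hw : w ∈ L.reg r) : b w = b' w := List.map_inj_left.1 h w hw

lemma get_state (v : Reg → ℕ) (r : Reg) : L.get (L.state v) r = bits (r.width n m) (v r) := by
  refine List.ext_getElem (by simp [get, L.length_reg, length_bits]) fun i h₁ h₂ => ?_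
  simp only [get, List.getElem_map, state]
  have hi : i < (L.reg r).length := by simpa [get] using h₁
  have hr : (L.exists_mem_reg (L.reg r)[i]).choose = r := by
    by_contra hne
    exact L.disjoint_reg _ _ hne (L.exists_mem_reg (L.reg r)[i]).choose_spec (List.getElem_mem _)
  simp only [hr]
  rw [(L.nodup_reg r).idxOf_getElem, List.getD_eq_getElem]

lemma state_eq_false {v : Reg → ℕ} {r : Reg} (hv : v r = 0) {w : Fin q} (hw : w ∈ L.reg r) :
    L.state v w = false := by
  have h := L.get_state v r
  rw [hv, bits_zero] at h
  have hm : L.state v w ∈ L.get (L.state v) r := List.mem_map_of_mem hw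
  rw [h] at hm
  exact List.eq_of_mem_replicate hm

lemma setBits_state (v : Reg → ℕ) (r : Reg) (k : ℕ) :
    setBits (L.state v) (L.reg r) (bits (r.width n m) k) = L.state (update v r k) := by
  refine L.ext fun r' => ?_
  rw [get_state]
  by_cases h : r' = r
  · subst h
    rw [update_self]
    exact map_setBits (L.nodup_reg _) _ (by rw [length_bits, L.length_reg])
  · rw [update_of_ne h, ← L.get_state v r']
    exact map_setBits_of_disjoint (L.disjoint_reg _ _ h) _ _

variable {κ : Type} {mem : κ → List Bool → ℝ}

lemma get_eq_of_agree {b b' : Fin q → Bool} {r : Reg} (h : ∀ w ∉ L.reg r, b' w = b w) {r' : Reg}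
    (hr : r' ≠ r) : L.get b' r' = L.get b r' :=
  List.map_congr_left fun w hw => h w fun hw' => L.disjoint_reg _ _ hr hw hw'

lemma get_eq_of_mat_ne_zero {c : Circuit κ q} {r : Reg}
    (hr : (Circuit.targets c).Disjoint (L.reg r)) {b' b : Fin q → Bool}
    (h : Circuit.mat mem c b' b ≠ 0) : L.get b' r = L.get b r :=
  List.map_congr_left fun w hw => by
    by_contra hne
    exact h (Circuit.mat_eq_zero (fun hm => hr hm hw) hne)

/-- The number in a register. -/
def val (r : Reg) : AngleExpr κ q := valExpr (L.reg r)

/-- The content of a register as a part of an address. -/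
def addr (r : Reg) : List (Fin q ⊕ Bool) := (L.reg r).map Sum.inl

lemma eval_val (r : Reg) (b : Fin q → Bool) :
    (L.val r).eval mem b = (bitsVal (L.get b r) : ℝ) := eval_valExpr _ _

lemma map_addr (r : Reg) (b : Fin q → Bool) : (L.addr r).map (Sum.elim b id) = L.get b r := by
  simp [addr, get, Function.comp_def]

lemma write_sends {c : ℕ} (hc : 0 < c) {V : AngleExpr κ q} {x : ℕ} {r : Reg} {v : Reg → ℕ}
    (hv : v r = 0)
    (hV : ∀ b, (∀ r' ≠ r, L.get b r' = bits (r'.width n m) (v r')) → V.eval mem b = x)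
    (hx : x / c < 2 ^ r.width n m) :
    Circuit.Sends mem (write c V (L.reg r)) (L.state v) (L.state (update v r (x / c))) := by
  rw [← L.setBits_state, ← L.length_reg r]
  refine QuantumIPM.write_sends hc (L.nodup_reg r) (fun w hw => L.state_eq_false hv hw)
    (fun b hb => hV b fun r' hr' => ?_) (by rwa [L.length_reg])
  rw [L.get_eq_of_agree hb hr', L.get_state]

lemma load_mul_sqrt {W : List (Fin q ⊕ Bool) → AngleExpr κ q} (ω : List Bool → ℝ) {r : Reg}
    {v v' : Reg → ℕ} {k : ℕ} (hv : v r = 0) (hv' : v' = update v r k)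
    (hW : ∀ b, (∀ r' ≠ r, L.get b r' = bits (r'.width n m) (v r')) →
      ∀ a, (W a).eval mem b = ω (a.map (Sum.elim b id)))
    (h0 : ∀ p, 0 ≤ ω p)
    (hadd : ∀ p, p.length < r.width n m → ω p = ω (p ++ [false]) + ω (p ++ [true])) :
    Circuit.mat mem (load W (L.reg r)) (L.state v') (L.state v) * √(ω []) =
      √(ω (bits (r.width n m) k)) := by
  rw [hv', ← L.setBits_state]
  refine QuantumIPM.load_mul_sqrt (L.nodup_reg r) (fun w hw => L.state_eq_false hv hw)
    (fun b hb => hW b fun r' hr' => ?_) h0 (by rwa [L.length_reg])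
    (by rw [length_bits, L.length_reg])
  rw [L.get_eq_of_agree hb hr', L.get_state]

lemma load_of_eq_zero {W : List (Fin q ⊕ Bool) → AngleExpr κ q} {r : Reg} {v : Reg → ℕ}
    (hW : ∀ b, (∀ r' ≠ r, L.get b r' = bits (r'.width n m) (v r')) → ∀ a, (W a).eval mem b = 0) :
    Circuit.mat mem (load W (L.reg r)) (L.state v) (L.state v) = 1 := by
  refine ((load_sends_self fun b hb => hW b fun r' hr' => ?_).apply _).trans (if_pos rfl)
  rw [L.get_eq_of_agree hb hr', L.get_state]

/-- The first part of a circuit fills the register `r`, which the second part does not change. -/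
lemma mat_append_update {c₁ c₂ : Circuit κ q} {r : Reg} (h₁ : Circuit.targets c₁ = L.reg r)
    (h₂ : (L.reg r).Disjoint (Circuit.targets c₂)) {v v' : Reg → ℕ} {k : ℕ} (hk : v' r = k) :
    Circuit.mat mem (c₁ ++ c₂) (L.state v') (L.state v) =
      Circuit.mat mem c₂ (L.state v') (L.state (update v r k)) *
        Circuit.mat mem c₁ (L.state (update v r k)) (L.state v) := by
  subst hk
  refine Circuit.mat_append_apply (by rwa [h₁]) (fun w hw => ?_) (fun w hw => ?_)
  · rw [h₁] at hw
    refine L.eq_of_get_eq ?_ hw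
    rw [get_state, get_state, update_self]
  · obtain ⟨r', hr'⟩ := L.exists_mem_reg w
    refine L.eq_of_get_eq ?_ hr'
    have : r' ≠ r := by rintro rfl; exact hw (h₁ ▸ hr')
    rw [get_state, get_state, update_of_ne this]

end Layout

/-! ### The content of the trees -/

section Trees

variable {ι : Type} [Fintype ι] {enc : ι → List Bool} {v : ι → ℝ}

lemma treeStore_weight_nonneg (w : List Bool) : 0 ≤ treeStore enc v .weight w :=
  Finset.sum_nonneg fun i _ => by split_ifs <;> positivity

lemma treeStore_weight_nil : treeStore enc v .weight [] = ∑ i, v i ^ 2 := by simp [treeStore]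

lemma isPrefix_iff_append_of_length_lt {w l : List Bool} (h : w.length < l.length) (x : ℝ) :
    (if w <+: l then x else 0) =
      (if w ++ [false] <+: l then x else 0) + (if w ++ [true] <+: l then x else 0) := by
  by_cases hw : w <+: l
  · obtain ⟨z, rfl⟩ := hw
    obtain _ | ⟨u, z⟩ := z
    · simp at h
    · cases u <;> simp [List.prefix_append_right_inj]
  · have : ∀ u, ¬ w ++ [u] <+: l := fun u hu => hw ((List.prefix_append _ _).trans hu)
    simp [hw, this]

lemma treeStore_weight_eq_add {s : ℕ} (hs : ∀ i, (enc i).length = s) {w : List Bool}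
    (hw : w.length < s) : treeStore enc v .weight w =
      treeStore enc v .weight (w ++ [false]) + treeStore enc v .weight (w ++ [true]) := by
  simp only [treeStore]
  rw [← Finset.sum_add_distrib]
  exact Finset.sum_congr rfl fun i _ => isPrefix_iff_append_of_length_lt (by rwa [hs]) _

lemma treeStore_weight_leaf {s : ℕ} (hs : ∀ i, (enc i).length = s) (he : Injective enc) (i : ι) :
    treeStore enc v .weight (enc i) = v i ^ 2 := by
  simp only [treeStore]
  rw [Finset.sum_eq_single i]
  · simp
  · intro j _ hj
    refine if_neg fun h => hj (he ?_)
    exact (h.eq_of_length (by rw [hs, hs])).symm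
  · simp

lemma treeStore_sign_leaf (he : Injective enc) (i : ι) :
    treeStore enc v .sign (enc i) = Real.sign (v i) := by
  simp only [treeStore]
  rw [Finset.sum_eq_single i (fun j _ hj => if_neg fun h => hj (he h)) (by simp), if_pos rfl]

end Trees

lemma bits_fin_injective (n : ℕ) : Injective fun i : Fin n => bits (Nat.clog 2 n) i := by
  intro i j h
  have hn := Nat.le_pow_clog (b := 2) (by norm_num) n
  exact Fin.ext (bits_inj (by omega) (by omega) h)

lemma append_bits_inj {a b : ℕ} {s : ℕ} {l l' : List Bool}
    (h : bits s a ++ l = bits s b ++ l') : bits s a = bits s b ∧ l = l' :=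
  List.append_inj h (by rw [length_bits, length_bits])

section Matrices

variable {n m : ℕ} (Z : Matrix (Fin n) (Fin n) ℝ) (A : Fin m → Matrix (Fin n) (Fin n) ℝ)

lemma matrixStore_enc_injective : Injective fun p : Fin n × Fin n =>
    bits (Nat.clog 2 n) p.1 ++ bits (Nat.clog 2 n) p.2 := by
  intro p p' h
  obtain ⟨h₁, h₂⟩ := append_bits_inj h
  exact Prod.ext (bits_fin_injective n h₁) (bits_fin_injective n h₂)

lemma fibersStore_enc_injective : Injective fun p : (Fin n × Fin n) × Fin m =>
    bits (Nat.clog 2 n) p.1.1 ++ bits (Nat.clog 2 n) p.1.2 ++ bits (Nat.clog 2 m) p.2 := by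
  intro p p' h
  simp only [List.append_assoc] at h
  obtain ⟨h₁, h₂⟩ := append_bits_inj h
  obtain ⟨h₂, h₃⟩ := append_bits_inj h₂
  exact Prod.ext (Prod.ext (bits_fin_injective n h₁) (bits_fin_injective n h₂))
    (bits_fin_injective m h₃)

lemma matrixStore_weight_nonneg (w : List Bool) : 0 ≤ matrixStore Z .weight w :=
  treeStore_weight_nonneg w

lemma fibersStore_weight_nonneg (w : List Bool) : 0 ≤ fibersStore A .weight w :=
  treeStore_weight_nonneg w

lemma matrixStore_weight_nil : matrixStore Z .weight [] = ∑ i, ∑ j, Z i j ^ 2 := by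
  rw [matrixStore, treeStore_weight_nil, Fintype.sum_prod_type]

lemma fibersStore_weight_nil :
    fibersStore A .weight [] = ∑ p : Fin n × Fin n, ∑ k, A k p.1 p.2 ^ 2 := by
  rw [fibersStore, treeStore_weight_nil, Fintype.sum_prod_type]

lemma matrixStore_weight_eq_add {w : List Bool} (hw : w.length < Nat.clog 2 n + Nat.clog 2 n) :
    matrixStore Z .weight w =
      matrixStore Z .weight (w ++ [false]) + matrixStore Z .weight (w ++ [true]) :=
  treeStore_weight_eq_add (by simp [length_bits]) hw

lemma fibersStore_weight_eq_add {w : List Bool}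
    (hw : w.length < Nat.clog 2 n + Nat.clog 2 n + Nat.clog 2 m) :
    fibersStore A .weight w =
      fibersStore A .weight (w ++ [false]) + fibersStore A .weight (w ++ [true]) :=
  treeStore_weight_eq_add (by simp [length_bits, add_assoc]) hw

lemma sqrt_matrixStore_weight_leaf (i j : Fin n) :
    √(matrixStore Z .weight (bits (Nat.clog 2 n) i ++ bits (Nat.clog 2 n) j)) = |Z i j| := by
  rw [matrixStore, treeStore_weight_leaf (s := Nat.clog 2 n + Nat.clog 2 n) (by simp [length_bits])
    matrixStore_enc_injective (i, j), Real.sqrt_sq_eq_abs]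

lemma sqrt_fibersStore_weight_leaf (i j : Fin n) (k : Fin m) :
    √(fibersStore A .weight (bits (Nat.clog 2 n) i ++ (bits (Nat.clog 2 n) j ++ bits (Nat.clog 2 m) k))) =
      |A k i j| := by
  rw [← List.append_assoc, fibersStore,
    treeStore_weight_leaf (s := Nat.clog 2 n + Nat.clog 2 n + Nat.clog 2 m)
      (by simp [length_bits, add_assoc]) fibersStore_enc_injective ((i, j), k), Real.sqrt_sq_eq_abs]

lemma matrixStore_sign_leaf (i j : Fin n) :
    matrixStore Z .sign (bits (Nat.clog 2 n) i ++ bits (Nat.clog 2 n) j) = Real.sign (Z i j) :=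
  treeStore_sign_leaf matrixStore_enc_injective (i, j)

lemma fibersStore_sign_leaf (i j : Fin n) (k : Fin m) :
    fibersStore A .sign (bits (Nat.clog 2 n) i ++ (bits (Nat.clog 2 n) j ++ bits (Nat.clog 2 m) k)) =
      Real.sign (A k i j) := by
  rw [← List.append_assoc]
  exact treeStore_sign_leaf fibersStore_enc_injective ((i, j), k)

end Matrices

/-! ### The matrix of the Newton system -/

section Newton

variable {n m : ℕ} (A : Fin m → Matrix (Fin n) (Fin n) ℝ) (S Y : Matrix (Fin n) (Fin n) ℝ)

lemma tilde_mul_hat_apply (Z S : Matrix (Fin n) (Fin n) ℝ) (p c : Fin n × Fin n) :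
    (tildeMatrix Z * hatMatrix S) p c = Z c.1 p.2 * S c.2 p.1 := by
  simp [Matrix.mul_apply, tildeMatrix, hatMatrix, Fintype.sum_prod_type]

lemma newtonM2_apply (z : (Fin n × Fin n) ⊕ Fin m) (z' : Fin m ⊕ (Fin n × Fin n)) :
    newtonM2 A S Y (rowIndex n m z) (colIndex n m z') =
      Matrix.fromBlocks (vecMatrix A).transpose (tildeMatrix Y⁻¹ * hatMatrix S) 0 (vecMatrix A)
        z z' := by
  simp only [newtonM2, Matrix.reindex_apply, Matrix.submatrix_apply, Equiv.symm_apply_apply]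

lemma frobeniusNorm_eq {d : ℕ} (M : Matrix (Fin d) (Fin d) ℝ) :
    frobeniusNorm M = √(∑ i, ∑ j, M i j ^ 2) := by
  simp [frobeniusNorm, Matrix.frobenius_norm_def, Real.sqrt_eq_rpow]

/-- `‖M₂‖² = 2 ∑ₖ ‖A k‖² + ‖Y⁻¹‖² ‖S‖²` for the Frobenius norms. -/
lemma frobeniusNorm_newtonM2 : frobeniusNorm (newtonM2 A S Y) =
    √(fibersStore A .weight [] + matrixStore Y⁻¹ .weight [] * matrixStore S .weight [] +
      fibersStore A .weight []) := by
  rw [frobeniusNorm_eq, ← (rowIndex n m).sum_comp]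
  simp_rw [← (colIndex n m).sum_comp]
  congr 1
  simp only [newtonM2_apply, Fintype.sum_sum_type, Matrix.fromBlocks_apply₁₁, Matrix.fromBlocks_apply₁₂,
    Matrix.fromBlocks_apply₂₁, Matrix.fromBlocks_apply₂₂, Matrix.zero_apply,
    Matrix.transpose_apply, vecMatrix, tilde_mul_hat_apply, Finset.sum_add_distrib]
  rw [fibersStore_weight_nil, matrixStore_weight_nil, matrixStore_weight_nil]
  have h1 : ∑ k, ∑ p : Fin n × Fin n, A k p.1 p.2 ^ 2 = ∑ p : Fin n × Fin n, ∑ k, A k p.1 p.2 ^ 2 :=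
    Finset.sum_comm
  have h2 : ∑ p : Fin n × Fin n, ∑ c : Fin n × Fin n, (Y⁻¹ c.1 p.2 * S c.2 p.1) ^ 2 =
      (∑ i, ∑ j, Y⁻¹ i j ^ 2) * ∑ i, ∑ j, S i j ^ 2 := by
    simp_rw [Fintype.sum_prod_type, mul_pow]
    rw [Finset.sum_comm' (t' := Finset.univ) (s' := fun _ => Finset.univ) (by simp)]
    rw [Finset.sum_comm (f := fun i j => Y⁻¹ i j ^ 2), Finset.sum_comm (f := fun i j => S i j ^ 2),
      Finset.sum_mul_sum]
    refine Finset.sum_congr rfl fun j _ => Finset.sum_congr rfl fun i _ => ?_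
    rw [Finset.sum_mul_sum]
  rw [h1, h2]
  simp [add_assoc]

end Newton

/-! ### Codes of rows and columns -/

/-- The numbers in the four registers of the code of a row or of a column. -/
structure Code where
  flag : ℕ
  fst : ℕ
  snd : ℕ
  idx : ℕ

/-- The code with zeros in all registers. -/
def Code.zero : Code := ⟨0, 0, 0, 0⟩

/-- The code of a row or of a column. -/
def Code.of {n m : ℕ} : (Fin n × Fin n) ⊕ Fin m → Code
  | .inl p => ⟨0, p.1, p.2, 0⟩
  | .inr k => ⟨1, 0, 0, k⟩

/-- The contents of the registers when the data register holds `d`, the row and column registers hold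
`P` and `Q`, and the others hold `0`. -/
def vals (d : ℕ) (P Q : Code) : Reg → ℕ
  | .data => d
  | .errRow | .errCol | .sgn => 0
  | .flag c => (cond c Q P).flag
  | .fst c => (cond c Q P).fst
  | .snd c => (cond c Q P).snd
  | .idx c => (cond c Q P).idx

namespace Layout

variable {n m q : ℕ} (L : Layout n m q) {κ : Type} {mem : κ → List Bool → ℝ}

/-- The negation of a flag. -/
def notFlag (c : Bool) : AngleExpr κ q := .add (.const 1) (.mul (.const (-1)) (L.val (.flag c)))

/-- Replace the number in the data register by its code. The expression `F` computes the flag, the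
numbers of the pairs start at `o₀` and those of the indices `k` at `o₁`. After the code has been
computed, the data register is cleared by the inverse of the circuit which would compute its
content from the code. -/
def encode (c : Bool) (F : AngleExpr κ q) (o₀ o₁ : ℕ) : Circuit κ q :=
  write 1 F (L.reg (.flag c)) ++
  (write n (.mul (L.notFlag c) (.add (L.val .data) (.const (-o₀)))) (L.reg (.fst c)) ++
  (write 1 (.add (.mul (L.notFlag c) (.add (L.val .data) (.const (-o₀))))
    (.mul (.const (-n)) (L.val (.fst c)))) (L.reg (.snd c)) ++
  (write 1 (.mul (L.val (.flag c)) (.add (L.val .data) (.const (-o₁)))) (L.reg (.idx c)) ++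
  (write 1 (.add (.add (.mul (.const n) (L.val (.fst c))) (L.val (.snd c)))
    (.add (L.val (.idx c)) (.add (.mul (L.notFlag c) (.const o₀))
      (.mul (L.val (.flag c)) (.const o₁))))) (L.reg .data)).reverse)))

lemma eval_val_of_get {b : Fin q → Bool} {r : Reg} {x : ℕ} (hb : L.get b r = bits (r.width n m) x)
    (hx : x < 2 ^ r.width n m) : (L.val r).eval mem b = x := by
  rw [eval_val, hb, bitsVal_bits hx]

/-- The effect of `encode` on a number `x` with the code `Q`, with the identities between real numbers
that say that each step of the arithmetic finds the next part of the code. -/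
lemma encode_sends {c : Bool} {F : AngleExpr κ q} {o₀ o₁ x y : ℕ} {v : Reg → ℕ} {Q : Code}
    (hn : 0 < n) (hv : v .data = x) (hflag : v (.flag c) = 0) (hfst : v (.fst c) = 0)
    (hsnd : v (.snd c) = 0) (hidx : v (.idx c) = 0)
    (hx : x < 2 ^ Reg.data.width n m) (hf2 : Q.flag < 2 ^ (Reg.flag c).width n m)
    (hi2 : Q.fst < 2 ^ (Reg.fst c).width n m)
    (hj2 : Q.snd < 2 ^ (Reg.snd c).width n m) (hk2 : Q.idx < 2 ^ (Reg.idx c).width n m)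
    (hF : ∀ b, L.get b .data = bits (Reg.data.width n m) x → F.eval mem b = (Q.flag : ℝ))
    (h₁ : (1 - Q.flag : ℝ) * (x - o₀) = y) (hy : y / n = Q.fst)
    (h₂ : (y - n * Q.fst : ℝ) = Q.snd) (h₃ : (Q.flag : ℝ) * (x - o₁) = Q.idx)
    (h₄ : (n * Q.fst + Q.snd + (Q.idx + ((1 - Q.flag) * o₀ + Q.flag * o₁)) : ℝ) = x) :
    Circuit.Sends mem (L.encode c F o₀ o₁) (L.state v)
      (L.state (update (update (update (update (update v (.flag c) Q.flag) (.fst c) Q.fst)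
        (.snd c) Q.snd) (.idx c) Q.idx) .data 0)) := by
  have hnot : ∀ b, L.get b (.flag c) = bits ((Reg.flag c).width n m) Q.flag →
      (L.notFlag c).eval mem b = 1 - (Q.flag : ℝ) := by
    intro b hb
    simp only [notFlag, AngleExpr.eval, L.eval_val_of_get hb hf2]
    push_cast; ring
  have hV₁ : ∀ b, L.get b (.flag c) = bits ((Reg.flag c).width n m) Q.flag →
      L.get b .data = bits (Reg.data.width n m) x →
      AngleExpr.eval mem b (.mul (L.notFlag c) (.add (L.val .data) (.const (-o₀)))) = (y : ℝ) := by
    intro b hb hd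
    simp only [AngleExpr.eval, hnot b hb, L.eval_val_of_get hd hx, ← h₁]
    push_cast; ring
  refine Circuit.Sends.append (b₁ := L.state (update v (.flag c) Q.flag)) ?_
    (Circuit.Sends.append (b₁ := L.state (update (update v (.flag c) Q.flag) (.fst c) Q.fst)) ?_
    (Circuit.Sends.append (b₁ := L.state (update (update (update v (.flag c) Q.flag) (.fst c) Q.fst)
        (.snd c) Q.snd)) ?_
    (Circuit.Sends.append (b₁ := L.state (update (update (update (update v (.flag c) Q.flag)
        (.fst c) Q.fst) (.snd c) Q.snd) (.idx c) Q.idx)) ?_ (Circuit.Sends.reverse ?_))))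
  · have h := L.write_sends (mem := mem) (c := 1) one_pos (V := F) (x := Q.flag) (r := .flag c) hflag
      (fun b hb => hF b (by rw [hb _ (by simp), hv])) (by simpa using hf2)
    simpa only [Nat.div_one] using h
  · rw [← hy]
    refine L.write_sends hn (by simpa using hfst) (fun b hb => hV₁ b ?_ ?_) (by rwa [hy])
    · rw [hb _ (by simp)]; simp
    · rw [hb _ (by simp)]; simp [hv]
  · have h := L.write_sends (mem := mem) (c := 1) one_pos (V := .add (.mul (L.notFlag c)
      (.add (L.val .data) (.const (-o₀)))) (.mul (.const (-n)) (L.val (.fst c)))) (x := Q.snd)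
      (r := .snd c) (v := update (update v (.flag c) Q.flag) (.fst c) Q.fst) (by simpa using hsnd)
      (fun b hb => ?_) (by simpa using hj2)
    · simpa only [Nat.div_one] using h
    · rw [AngleExpr.eval, hV₁ b (by rw [hb _ (by simp)]; simp) (by rw [hb _ (by simp)]; simp [hv])]
      simp only [AngleExpr.eval]
      rw [L.eval_val_of_get (x := Q.fst) (by rw [hb _ (by simp)]; simp) hi2, ← h₂]
      push_cast; ring
  · have h := L.write_sends (mem := mem) (c := 1) one_pos (V := .mul (L.val (.flag c))
      (.add (L.val .data) (.const (-o₁)))) (x := Q.idx)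
      (r := .idx c) (v := update (update (update v (.flag c) Q.flag) (.fst c) Q.fst) (.snd c) Q.snd)
      (by simpa using hidx) (fun b hb => ?_) (by simpa using hk2)
    · simpa only [Nat.div_one] using h
    · simp only [AngleExpr.eval]
      rw [L.eval_val_of_get (x := Q.flag) (by rw [hb _ (by simp)]; simp) hf2,
        L.eval_val_of_get (x := x) (by rw [hb _ (by simp)]; simp [hv]) hx, ← h₃]
      push_cast; ring
  · set v₄ := update (update (update (update v (.flag c) Q.flag)
        (.fst c) Q.fst) (.snd c) Q.snd) (.idx c) Q.idx with hv₄
    have hd : v₄ .data = x := by simp [hv₄, hv]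
    have h := L.write_sends (mem := mem) (c := 1) one_pos
      (V := .add (.add (.mul (.const n) (L.val (.fst c))) (L.val (.snd c)))
        (.add (L.val (.idx c)) (.add (.mul (L.notFlag c) (.const o₀))
        (.mul (L.val (.flag c)) (.const o₁))))) (x := x) (r := .data) (v := update v₄ .data 0)
      (by simp) (fun b hb => ?_) (by simpa using hx)
    · rw [Nat.div_one, update_idem, ← hd, update_eq_self] at h
      exact h
    · have e₁ : L.get b (.flag c) = bits ((Reg.flag c).width n m) Q.flag := by
        rw [hb _ (by simp)]; simp [hv₄]
      simp only [AngleExpr.eval]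
      rw [hnot b e₁, L.eval_val_of_get e₁ hf2,
        L.eval_val_of_get (x := Q.fst) (by rw [hb _ (by simp)]; simp [hv₄]) hi2,
        L.eval_val_of_get (x := Q.snd) (by rw [hb _ (by simp)]; simp [hv₄]) hj2,
        L.eval_val_of_get (x := Q.idx) (by rw [hb _ (by simp)]; simp [hv₄]) hk2, ← h₄]
      push_cast; ring

/-- The number `o₀ + n i + j` or `o₁ + k` of a row or a column is replaced by its code. -/
lemma encode_sends_of {c : Bool} {F : AngleExpr κ q} {o₀ o₁ : ℕ} {v : Reg → ℕ}
    (z : (Fin n × Fin n) ⊕ Fin m)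
    (hv : v .data = Sum.elim (fun p : Fin n × Fin n => o₀ + (n * p.1 + p.2)) (fun k : Fin m => o₁ + (k : ℕ)) z)
    (hd : v .data < n * n + m)
    (hflag : v (.flag c) = 0) (hfst : v (.fst c) = 0)
    (hsnd : v (.snd c) = 0) (hidx : v (.idx c) = 0)
    (hF : ∀ b, L.get b .data = bits (Reg.data.width n m) (v .data) →
      F.eval mem b = ((Code.of z).flag : ℝ)) (hn : 0 < n) :
    Circuit.Sends mem (L.encode c F o₀ o₁) (L.state v)
      (L.state (update (update (update (update (update v (.flag c) (Code.of z).flag)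
        (.fst c) (Code.of z).fst) (.snd c) (Code.of z).snd) (.idx c) (Code.of z).idx) .data 0)) := by
  have hN := Nat.le_pow_clog (b := 2) (by norm_num) (n * n + m)
  have hn' := Nat.le_pow_clog (b := 2) (by norm_num) n
  have hm' := Nat.le_pow_clog (b := 2) (by norm_num) m
  rcases z with ⟨i, j⟩ | k
  · refine L.encode_sends (y := n * i + j) hn rfl hflag hfst hsnd hidx (hd.trans_le hN) ?_ ?_ ?_ ?_
      hF ?_ ?_ ?_ ?_ ?_
    · simp [Code.of]
    · exact i.2.trans_le hn'
    · exact j.2.trans_le hn'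
    · simp [Code.of]
    · rw [hv]; simp [Code.of]
    · rw [Nat.mul_add_div hn, Nat.div_eq_of_lt j.2]; simp [Code.of]
    · simp [Code.of]
    · simp [Code.of]
    · rw [hv]; simp [Code.of]; ring
  · refine L.encode_sends (y := 0) hn rfl hflag hfst hsnd hidx (hd.trans_le hN) ?_ ?_ ?_ ?_
      hF ?_ ?_ ?_ ?_ ?_
    · simp [Code.of, Reg.width]
    · simp [Code.of]
    · simp [Code.of]
    · exact k.2.trans_le hm'
    · simp [Code.of]
    · simp [Code.of]
    · simp [Code.of]
    · rw [hv]; simp [Code.of]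
    · rw [hv]; simp [Code.of]; ring

end Layout

lemma update_vals_flag (c : Bool) (P Q : Code) (x : ℕ) :
    update (vals 0 P Q) (.flag c) x =
      vals 0 (cond c P { P with flag := x }) (cond c { Q with flag := x } Q) := by
  funext r
  cases c <;> rcases r with _ | _ | _ | _ | c' | c' | c' | c' <;> (try cases c') <;> simp [vals]

lemma update_vals_fst (c : Bool) (P Q : Code) (x : ℕ) :
    update (vals 0 P Q) (.fst c) x =
      vals 0 (cond c P { P with fst := x }) (cond c { Q with fst := x } Q) := by
  funext r
  cases c <;> rcases r with _ | _ | _ | _ | c' | c' | c' | c' <;> (try cases c') <;> simp [vals]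

lemma update_vals_snd (c : Bool) (P Q : Code) (x : ℕ) :
    update (vals 0 P Q) (.snd c) x =
      vals 0 (cond c P { P with snd := x }) (cond c { Q with snd := x } Q) := by
  funext r
  cases c <;> rcases r with _ | _ | _ | _ | c' | c' | c' | c' <;> (try cases c') <;> simp [vals]

lemma update_vals_idx (c : Bool) (P Q : Code) (x : ℕ) :
    update (vals 0 P Q) (.idx c) x =
      vals 0 (cond c P { P with idx := x }) (cond c { Q with idx := x } Q) := by
  funext r
  cases c <;> rcases r with _ | _ | _ | _ | c' | c' | c' | c' <;> (try cases c') <;> simp [vals]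

namespace Layout

variable {n m q : ℕ} (L : Layout n m q)

/-! ### The two state preparations -/

/-- A query to the QRAM. -/
def query (s : Store) (f : Field) (a : List (Fin q ⊕ Bool)) : AngleExpr (Store × Field) q :=
  .cell (s, f) a

/-- Prepare the code registers on the side `c`: the flag with the weights `e₀` and `e₁`, then the
registers of `k`, `i` and `j` from the trees with the weights `W₁`, `W₂` and `W₃`. -/
def prep (c : Bool) (e₀ e₁ : AngleExpr (Store × Field) q)
    (W₁ W₂ W₃ : List (Fin q ⊕ Bool) → AngleExpr (Store × Field) q) : Circuit (Store × Field) q :=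
  branch e₀ e₁ (L.reg (.flag c)) ++ (load W₁ (L.reg (.idx c)) ++
    (load W₂ (L.reg (.fst c)) ++ load W₃ (L.reg (.snd c))))

/-- With the code of a column given, prepare a superposition of codes of rows. The weight of a row in
the top part is its squared norm. In the bottom part the index `k` is distributed as in the fiber
`(A k i j)ₖ` of the given column `(i, j)`. -/
def rowPrep : Circuit (Store × Field) q :=
  L.prep false
    (.add (query .fibers .weight []) (.mul (query .Yinv .weight []) (query .S .weight [])))
    (query .fibers .weight [])
    (fun a => .mul (L.val (.flag false))
      (query .fibers .weight (L.addr (.fst true) ++ (L.addr (.snd true) ++ a))))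
    (fun a => .mul (L.notFlag false) (.add (query .fibers .weight a)
      (.mul (query .Yinv .weight []) (query .S .weight a))))
    (fun a => .mul (L.notFlag false) (.add (query .fibers .weight (L.addr (.fst false) ++ a))
      (.mul (query .S .weight (L.addr (.fst false))) (query .Yinv .weight a))))

/-- With the code of a row given, prepare a superposition of codes of columns. In the top part the
weight of a column is the square of the entry of `M₂`. In the bottom part the weight of the column
`(i, j)` is the squared norm of the fiber `(A k i j)ₖ`. -/
def colPrep : Circuit (Store × Field) q :=
  L.prep true
    (.mul (L.notFlag false) (.mul (query .S .weight (L.addr (.fst false)))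
      (query .Yinv .weight (L.addr (.snd false)))))
    (.mul (L.notFlag false)
      (query .fibers .weight (L.addr (.fst false) ++ L.addr (.snd false))))
    (fun a => .mul (.mul (L.notFlag false) (L.val (.flag true)))
      (query .fibers .weight (L.addr (.fst false) ++ (L.addr (.snd false) ++ a))))
    (fun a => .add
      (.mul (.mul (L.notFlag false) (L.notFlag true)) (query .Yinv .weight (L.addr (.snd false) ++ a)))
      (.mul (L.val (.flag false)) (query .fibers .weight a)))
    (fun a => .add
      (.mul (.mul (L.notFlag false) (L.notFlag true)) (query .S .weight (L.addr (.fst false) ++ a)))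
      (.mul (L.val (.flag false)) (query .fibers .weight (L.addr (.fst true) ++ a))))

/-- The sign of the entry of `M₂` in the row and the column whose codes are given. The three terms
belong to the three nonzero blocks, and the value is `0` if both flags are `1`. -/
def signExpr : AngleExpr (Store × Field) q :=
  .add (.mul (.mul (L.notFlag false) (L.notFlag true))
    (.mul (query .Yinv .sign (L.addr (.snd false) ++ L.addr (.fst true)))
      (query .S .sign (L.addr (.fst false) ++ L.addr (.snd true)))))
  (.add (.mul (.mul (L.notFlag false) (L.val (.flag true)))
    (query .fibers .sign (L.addr (.fst false) ++ (L.addr (.snd false) ++ L.addr (.idx true)))))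
  (.mul (.mul (L.val (.flag false)) (L.notFlag true))
    (query .fibers .sign (L.addr (.fst true) ++ (L.addr (.snd true) ++ L.addr (.idx false))))))

lemma targets_append {κ : Type} (c₁ c₂ : Circuit κ q) :
    Circuit.targets (c₁ ++ c₂) = Circuit.targets c₁ ++ Circuit.targets c₂ := List.map_append

lemma targets_prep (c : Bool) (e₀ e₁ : AngleExpr (Store × Field) q)
    (W₁ W₂ W₃ : List (Fin q ⊕ Bool) → AngleExpr (Store × Field) q) :
    Circuit.targets (L.prep c e₀ e₁ W₁ W₂ W₃) = L.reg (.flag c) ++ (L.reg (.idx c) ++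
      (L.reg (.fst c) ++ L.reg (.snd c))) := by
  simp only [prep, targets_append, targets_branch, targets_load]

section Amplitudes

variable {mem : Store × Field → List Bool → ℝ}

/-- The amplitude of a basis state is the product of the amplitudes found on the path to it. -/
lemma mat_prep {c : Bool} {e₀ e₁ : AngleExpr (Store × Field) q}
    {W₁ W₂ W₃ : List (Fin q ⊕ Bool) → AngleExpr (Store × Field) q} {v v₁ v₂ v₃ v₄ : Reg → ℕ}
    {f i j k : ℕ} (h₁ : v₁ = update v (.flag c) f) (h₂ : v₂ = update v₁ (.idx c) k)
    (h₃ : v₃ = update v₂ (.fst c) i) (h₄ : v₄ = update v₃ (.snd c) j) :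
    Circuit.mat mem (L.prep c e₀ e₁ W₁ W₂ W₃) (L.state v₄) (L.state v) =
      Circuit.mat mem (load W₃ (L.reg (.snd c))) (L.state v₄) (L.state v₃) *
      Circuit.mat mem (load W₂ (L.reg (.fst c))) (L.state v₃) (L.state v₂) *
      Circuit.mat mem (load W₁ (L.reg (.idx c))) (L.state v₂) (L.state v₁) *
      Circuit.mat mem (branch e₀ e₁ (L.reg (.flag c))) (L.state v₁) (L.state v) := by
  have hd : ∀ r r', r ≠ r' → (L.reg r).Disjoint (L.reg r') := L.disjoint_reg
  rw [prep, L.mat_append_update (targets_branch _ _ _) ?_ (k := f) (by simp [h₁, h₂, h₃, h₄]),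
    L.mat_append_update (targets_load _ _) ?_ (k := k) (by simp [h₂, h₃, h₄]),
    L.mat_append_update (targets_load _ _) ?_ (k := i) (by simp [h₃, h₄]),
    ← h₁, ← h₂, ← h₃]
  · simp only [targets_load]
    exact hd _ _ (by simp)
  · simp only [targets_load, targets_append, List.disjoint_append_right]
    exact ⟨hd _ _ (by simp), hd _ _ (by simp)⟩
  · simp only [targets_load, targets_append, List.disjoint_append_right]
    exact ⟨hd _ _ (by simp), hd _ _ (by simp), hd _ _ (by simp)⟩

lemma branch_mul_sqrt {e₀ e₁ : AngleExpr (Store × Field) q} {c : Bool} {v v' : Reg → ℕ}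
    {f : ℕ} (hv : v (.flag c) = 0) (hv' : v' = update v (.flag c) f) {ω₀ ω₁ : ℝ} (h₀ : 0 ≤ ω₀) (h₁ : 0 ≤ ω₁)
    (he₀ : e₀.eval mem (L.state v) = ω₀) (he₁ : e₁.eval mem (L.state v) = ω₁) :
    Circuit.mat mem (branch e₀ e₁ (L.reg (.flag c))) (L.state v') (L.state v) *
      √(ω₀ + ω₁) = √(cond (f.testBit 0) ω₁ ω₀) := by
  rw [hv', ← L.setBits_state]
  exact QuantumIPM.branch_mul_sqrt (L.length_reg _) (fun w hw => L.state_eq_false hv hw) h₀ h₁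
    he₀ he₁ _

lemma branch_of_eq_zero {e₀ e₁ : AngleExpr (Store × Field) q} {c : Bool} {v v' : Reg → ℕ}
    {f : ℕ} (hv : v (.flag c) = 0) (hv' : v' = update v (.flag c) f) (he₀ : e₀.eval mem (L.state v) = 0) (he₁ : e₁.eval mem (L.state v) = 0)
    (hf : f < 2) :
    Circuit.mat mem (branch e₀ e₁ (L.reg (.flag c))) (L.state v') (L.state v) =
      if f = 0 then 1 else 0 := by
  have h := branch_sends_self (mem := mem) (L.length_reg (.flag c))
    (fun w hw => L.state_eq_false hv hw) he₀ he₁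
  rw [h.apply, hv']
  congr 1
  rw [eq_iff_iff]
  refine ⟨fun hs => ?_, fun hs => by rw [hs, ← hv, update_eq_self]⟩
  have hg := congr_arg (fun b => L.get b (.flag c)) hs
  simp only [get_state, update_self, hv] at hg
  exact bits_inj (by simpa [Reg.width] using hf) (by simp) hg

lemma eval_notFlag {κ : Type} {mem : κ → List Bool → ℝ} (b : Fin q → Bool) (c : Bool) :
    (L.notFlag c).eval mem b = 1 - (bitsVal (L.get b (.flag c)) : ℝ) := by
  simp only [notFlag, AngleExpr.eval, L.eval_val]
  push_cast; ring

end Amplitudes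

end Layout

/-! ### The amplitudes of rows and columns -/

lemma bitsVal_bits_one_zero : bitsVal (bits 1 0) = 0 := bitsVal_bits (by norm_num)

lemma bitsVal_bits_one_one : bitsVal (bits 1 1) = 1 := bitsVal_bits (by norm_num)

/-- The telescoping of amplitudes along the stages of a preparation. -/
lemma mul_chain {m₁ m₂ m₃ m₄ x₀ x₁ x₂ x₃ x₄ : ℝ} (h₁ : m₁ * x₀ = x₁) (h₂ : m₂ * x₁ = x₂)
    (h₃ : m₃ * x₂ = x₃) (h₄ : m₄ * x₃ = x₄) : m₄ * m₃ * m₂ * m₁ * x₀ = x₄ := by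
  rw [mul_assoc, h₁, mul_assoc, h₂, mul_assoc, h₃, h₄]

lemma mul_eq_of_eq_one {x y : ℝ} (h : x = 1) : x * y = y := by rw [h, one_mul]

namespace Layout

variable {n m q : ℕ} (L : Layout n m q)
  (A : Fin m → Matrix (Fin n) (Fin n) ℝ) (S Y : Matrix (Fin n) (Fin n) ℝ)

/-- The amplitude of the row `(i, j)` is its norm divided by the norm of `M₂`. The weights of the flag,
of `i` and of `j` are matched so that the leaves of one tree are the root weights of the next. -/
lemma mat_rowPrep_inl (i j : Fin n) (Q : Code) :
    Circuit.mat (qram A S Y) L.rowPrep (L.state (vals 0 (.of (m := m) (.inl (i, j))) Q))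
      (L.state (vals 0 .zero Q)) * frobeniusNorm (newtonM2 A S Y) =
    √(fibersStore A .weight (bits (Nat.clog 2 n) i ++ bits (Nat.clog 2 n) j) +
      matrixStore S .weight (bits (Nat.clog 2 n) i) *
        matrixStore Y⁻¹ .weight (bits (Nat.clog 2 n) j)) := by
  have hF := fibersStore_weight_nonneg A
  have hS := matrixStore_weight_nonneg S
  have hY := matrixStore_weight_nonneg Y⁻¹
  rw [rowPrep, L.mat_prep (f := 0) (k := 0) (i := i) (j := j) (v := vals 0 .zero Q)
    (v₁ := vals 0 .zero Q) (v₂ := vals 0 .zero Q) (v₃ := vals 0 ⟨0, i, 0, 0⟩ Q)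
    (v₄ := vals 0 (.of (m := m) (.inl (i, j))) Q)
    (by rw [update_vals_flag]; rfl) (by rw [update_vals_idx]; rfl) (by rw [update_vals_fst]; rfl)
    (by rw [update_vals_snd]; rfl), frobeniusNorm_newtonM2]
  refine mul_chain
    (L.branch_mul_sqrt (f := 0) rfl (by rw [update_vals_flag]; rfl)
      (add_nonneg (hF _) (mul_nonneg (hY _) (hS _))) (hF _) rfl rfl)
    (x₂ := √(fibersStore A .weight [] + matrixStore Y⁻¹ .weight [] * matrixStore S .weight [])) ?_
    (L.load_mul_sqrt (k := i) (fun p => fibersStore A .weight p +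
      matrixStore Y⁻¹ .weight [] * matrixStore S .weight p) rfl (by rw [update_vals_fst]; rfl)
      (fun b hb a => ?_) (fun p => add_nonneg (hF _) (mul_nonneg (hY _) (hS _))) (fun p hp => ?_))
    ((congr_arg (_ * ·) ?_).trans (L.load_mul_sqrt (k := j)
      (fun p => fibersStore A .weight (bits (Nat.clog 2 n) i ++ p) +
      matrixStore S .weight (bits (Nat.clog 2 n) i) * matrixStore Y⁻¹ .weight p)
      rfl (by rw [update_vals_snd]; rfl)
      (fun b hb a => ?_) (fun p => add_nonneg (hF _) (mul_nonneg (hS _) (hY _))) (fun p hp => ?_)))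
  · rw [L.load_of_eq_zero fun b hb a => ?_, one_mul]
    · rfl
    · simp [AngleExpr.eval, L.eval_val, hb, vals, Code.zero, Reg.width, bitsVal_bits_one_zero]
  · simp [AngleExpr.eval, query, L.eval_notFlag, hb, vals, Code.zero, Reg.width,
      bitsVal_bits_one_zero, qram]
  · simp only [Reg.width] at hp
    rw [fibersStore_weight_eq_add A (by omega), matrixStore_weight_eq_add S (by omega)]
    ring
  · simp [Reg.width, mul_comm]
  · simp [AngleExpr.eval, query, L.eval_notFlag, L.map_addr, hb, vals, Reg.width,
      bitsVal_bits_one_zero, qram]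
  · simp only [Reg.width] at hp
    rw [fibersStore_weight_eq_add A (by simp [length_bits]; omega),
      matrixStore_weight_eq_add Y⁻¹ (by omega)]
    simp only [List.append_assoc]
    ring

/-- With the column `(i, j)` given, the amplitude of the row `k` is `‖A‖ x / ‖M₂‖`, where `x` is
`|A k i j|` divided by the norm of the fiber `(A k i j)ₖ`. As that norm may be zero, `x` is only given
by an equation without division. -/
lemma mat_rowPrep_inr (k : Fin m) (i j : Fin n) :
    ∃ x : ℝ, Circuit.mat (qram A S Y) L.rowPrep
      (L.state (vals 0 (.of (n := n) (.inr k)) (.of (m := m) (.inl (i, j)))))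
      (L.state (vals 0 .zero (.of (m := m) (.inl (i, j))))) * frobeniusNorm (newtonM2 A S Y) =
        √(fibersStore A .weight []) * x ∧
      x * √(fibersStore A .weight (bits (Nat.clog 2 n) i ++ bits (Nat.clog 2 n) j)) =
        |A k i j| := by
  have hF := fibersStore_weight_nonneg A
  have hS := matrixStore_weight_nonneg S
  have hY := matrixStore_weight_nonneg Y⁻¹
  set Q : Code := .of (m := m) (.inl (i, j)) with hQ
  rw [rowPrep, L.mat_prep (f := 1) (k := k) (i := 0) (j := 0) (v := vals 0 .zero Q)
    (v₁ := vals 0 ⟨1, 0, 0, 0⟩ Q) (v₂ := vals 0 (.of (n := n) (.inr k)) Q)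
    (v₃ := vals 0 (.of (n := n) (.inr k)) Q)
    (v₄ := vals 0 (.of (n := n) (.inr k)) Q)
    (by rw [update_vals_flag]; rfl) (by rw [update_vals_idx]; rfl) (by rw [update_vals_fst]; rfl)
    (by rw [update_vals_snd]; rfl), frobeniusNorm_newtonM2, ← sqrt_fibersStore_weight_leaf]
  refine ⟨_, mul_chain
    (L.branch_mul_sqrt (f := 1) rfl (by rw [update_vals_flag]; rfl)
      (add_nonneg (hF _) (mul_nonneg (hY _) (hS _))) (hF _) rfl rfl)
    (mul_comm _ _) (mul_eq_of_eq_one ?_) (mul_eq_of_eq_one ?_),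
    (congr_arg (_ * ·) ?_).trans (L.load_mul_sqrt (k := k)
      (fun p => fibersStore A .weight (bits (Nat.clog 2 n) i ++ (bits (Nat.clog 2 n) j ++ p)))
      rfl (by rw [update_vals_idx]; rfl) (fun b hb a => ?_) (fun p => hF _) (fun p hp => ?_))⟩
  · rw [L.load_of_eq_zero fun b hb a => ?_]
    simp [AngleExpr.eval, L.eval_notFlag, hb, vals, Code.of, Reg.width, bitsVal_bits_one_one]
  · rw [L.load_of_eq_zero fun b hb a => ?_]
    simp [AngleExpr.eval, L.eval_notFlag, hb, vals, Code.of, Reg.width, bitsVal_bits_one_one]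
  · simp
  · simp [AngleExpr.eval, query, L.eval_val, L.map_addr, hb, vals, Reg.width,
      bitsVal_bits_one_one, qram, hQ, Code.of]
  · simp only [Reg.width] at hp
    rw [fibersStore_weight_eq_add A (by simp [length_bits]; omega)]
    simp only [List.append_assoc]

lemma mat_colPrep_inl_inl (i j a b : Fin n) :
    Circuit.mat (qram A S Y) L.colPrep
      (L.state (vals 0 (.of (m := m) (.inl (i, j))) (.of (m := m) (.inl (a, b)))))
      (L.state (vals 0 (.of (m := m) (.inl (i, j))) .zero)) *
    √(fibersStore A .weight (bits (Nat.clog 2 n) i ++ bits (Nat.clog 2 n) j) +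
      matrixStore S .weight (bits (Nat.clog 2 n) i) *
        matrixStore Y⁻¹ .weight (bits (Nat.clog 2 n) j)) = |Y⁻¹ j a| * |S i b| := by
  have hF := fibersStore_weight_nonneg A
  have hS := matrixStore_weight_nonneg S
  have hY := matrixStore_weight_nonneg Y⁻¹
  set P : Code := .of (m := m) (.inl (i, j)) with hP
  rw [colPrep, L.mat_prep (f := 0) (k := 0) (i := a) (j := b) (v := vals 0 P .zero)
    (v₁ := vals 0 P .zero) (v₂ := vals 0 P .zero) (v₃ := vals 0 P ⟨0, a, 0, 0⟩)
    (v₄ := vals 0 P (.of (m := m) (.inl (a, b))))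
    (by rw [update_vals_flag]; rfl) (by rw [update_vals_idx]; rfl) (by rw [update_vals_fst]; rfl)
    (by rw [update_vals_snd]; rfl), add_comm (fibersStore A _ _)]
  refine mul_chain
    (x₁ := √(matrixStore Y⁻¹ .weight (bits (Nat.clog 2 n) j)) *
      √(matrixStore S .weight (bits (Nat.clog 2 n) i)))
    ((L.branch_mul_sqrt (f := 0) rfl (by rw [update_vals_flag]; rfl)
      (mul_nonneg (hS _) (hY _)) (hF _) ?_ ?_).trans ?_)
    (x₂ := √(matrixStore Y⁻¹ .weight (bits (Nat.clog 2 n) j)) *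
      √(matrixStore S .weight (bits (Nat.clog 2 n) i))) ?_
    (x₃ := |Y⁻¹ j a| * √(matrixStore S .weight (bits (Nat.clog 2 n) i)))
    ((mul_assoc _ _ _).symm.trans (congr_arg (· * _) ?_))
    ((mul_left_comm _ _ _).trans (congr_arg (|Y⁻¹ j a| * ·) ?_))
  · simp [AngleExpr.eval, query, L.eval_notFlag, L.map_addr, L.get_state, vals, Reg.width,
      bitsVal_bits_one_zero, qram, hP, Code.of]
  · simp [AngleExpr.eval, query, L.eval_notFlag, L.map_addr, L.get_state, vals, Reg.width,
      bitsVal_bits_one_zero, qram, hP, Code.of]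
  · rw [Nat.zero_testBit, cond_false, Real.sqrt_mul (hS _), mul_comm]
  · rw [L.load_of_eq_zero fun b hb a => ?_, one_mul]
    simp [AngleExpr.eval, L.eval_val, hb, vals, Code.zero, Reg.width, bitsVal_bits_one_zero]
  · rw [← sqrt_matrixStore_weight_leaf]
    refine ((congr_arg (_ * ·) ?_).trans (L.load_mul_sqrt (k := a)
      (fun p => matrixStore Y⁻¹ .weight (bits (Nat.clog 2 n) j ++ p))
      rfl (by rw [update_vals_fst]; rfl) (fun b hb a => ?_) (fun p => hY _) (fun p hp => ?_)))
    · simp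
    · simp [AngleExpr.eval, query, L.eval_val, L.eval_notFlag, L.map_addr, hb, vals, Reg.width,
        bitsVal_bits_one_zero, qram, hP, Code.of, Code.zero]
    · simp only [Reg.width] at hp
      rw [matrixStore_weight_eq_add Y⁻¹ (by simp [length_bits]; omega)]
      simp only [List.append_assoc]
  · rw [← sqrt_matrixStore_weight_leaf]
    refine ((congr_arg (_ * ·) ?_).trans (L.load_mul_sqrt (k := b)
      (fun p => matrixStore S .weight (bits (Nat.clog 2 n) i ++ p))
      rfl (by rw [update_vals_snd]; rfl) (fun b hb a => ?_) (fun p => hS _) (fun p hp => ?_)))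
    · simp
    · simp [AngleExpr.eval, query, L.eval_val, L.eval_notFlag, L.map_addr, hb, vals, Reg.width,
        bitsVal_bits_one_zero, qram, hP, Code.of]
    · simp only [Reg.width] at hp
      rw [matrixStore_weight_eq_add S (by simp [length_bits]; omega)]
      simp only [List.append_assoc]

lemma mat_colPrep_inl_inr (i j : Fin n) (k : Fin m) :
    Circuit.mat (qram A S Y) L.colPrep
      (L.state (vals 0 (.of (m := m) (.inl (i, j))) (.of (n := n) (.inr k))))
      (L.state (vals 0 (.of (m := m) (.inl (i, j))) .zero)) *
    √(fibersStore A .weight (bits (Nat.clog 2 n) i ++ bits (Nat.clog 2 n) j) +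
      matrixStore S .weight (bits (Nat.clog 2 n) i) *
        matrixStore Y⁻¹ .weight (bits (Nat.clog 2 n) j)) = |A k i j| := by
  have hF := fibersStore_weight_nonneg A
  have hS := matrixStore_weight_nonneg S
  have hY := matrixStore_weight_nonneg Y⁻¹
  set P : Code := .of (m := m) (.inl (i, j)) with hP
  rw [colPrep, L.mat_prep (f := 1) (k := k) (i := 0) (j := 0) (v := vals 0 P .zero)
    (v₁ := vals 0 P ⟨1, 0, 0, 0⟩) (v₂ := vals 0 P (.of (n := n) (.inr k)))
    (v₃ := vals 0 P (.of (n := n) (.inr k)))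
    (v₄ := vals 0 P (.of (n := n) (.inr k)))
    (by rw [update_vals_flag]; rfl) (by rw [update_vals_idx]; rfl) (by rw [update_vals_fst]; rfl)
    (by rw [update_vals_snd]; rfl), add_comm (fibersStore A _ _), ← sqrt_fibersStore_weight_leaf]
  refine mul_chain
    (L.branch_mul_sqrt (f := 1) rfl (by rw [update_vals_flag]; rfl)
      (mul_nonneg (hS _) (hY _)) (hF _) ?_ ?_)
    ((congr_arg (_ * ·) ?_).trans (L.load_mul_sqrt (k := k)
      (fun p => fibersStore A .weight (bits (Nat.clog 2 n) i ++ (bits (Nat.clog 2 n) j ++ p)))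
      rfl (by rw [update_vals_idx]; rfl) (fun b hb a => ?_) (fun p => hF _) (fun p hp => ?_)))
    (mul_eq_of_eq_one ?_) (mul_eq_of_eq_one ?_)
  · simp [AngleExpr.eval, query, L.eval_notFlag, L.map_addr, L.get_state, vals, Reg.width,
      bitsVal_bits_one_zero, qram, hP, Code.of]
  · simp [AngleExpr.eval, query, L.eval_notFlag, L.map_addr, L.get_state, vals, Reg.width,
      bitsVal_bits_one_zero, qram, hP, Code.of]
  · simp
  · simp [AngleExpr.eval, query, L.eval_val, L.eval_notFlag, L.map_addr, hb, vals, Reg.width,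
      bitsVal_bits_one_zero, bitsVal_bits_one_one, qram, hP, Code.of]
  · simp only [Reg.width] at hp
    rw [fibersStore_weight_eq_add A (by simp [length_bits]; omega)]
    simp only [List.append_assoc]
  · rw [L.load_of_eq_zero fun b hb a => ?_]
    simp [AngleExpr.eval, L.eval_notFlag, L.eval_val, hb, vals, Code.of, Reg.width, hP,
      bitsVal_bits_one_one, bitsVal_bits_one_zero]
  · rw [L.load_of_eq_zero fun b hb a => ?_]
    simp [AngleExpr.eval, L.eval_notFlag, L.eval_val, hb, vals, Code.of, Reg.width, hP,
      bitsVal_bits_one_one, bitsVal_bits_one_zero]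

lemma mat_colPrep_inr_inl (k : Fin m) (i j : Fin n) :
    Circuit.mat (qram A S Y) L.colPrep
      (L.state (vals 0 (.of (n := n) (.inr k)) (.of (m := m) (.inl (i, j)))))
      (L.state (vals 0 (.of (n := n) (.inr k)) .zero)) * √(fibersStore A .weight []) =
    √(fibersStore A .weight (bits (Nat.clog 2 n) i ++ bits (Nat.clog 2 n) j)) := by
  have hF := fibersStore_weight_nonneg A
  set P : Code := .of (n := n) (.inr k) with hP
  rw [colPrep, L.mat_prep (f := 0) (k := 0) (i := i) (j := j) (v := vals 0 P .zero)
    (v₁ := vals 0 P .zero) (v₂ := vals 0 P .zero) (v₃ := vals 0 P ⟨0, i, 0, 0⟩)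
    (v₄ := vals 0 P (.of (m := m) (.inl (i, j))))
    (by rw [update_vals_flag]; rfl) (by rw [update_vals_idx]; rfl) (by rw [update_vals_fst]; rfl)
    (by rw [update_vals_snd]; rfl)]
  refine mul_chain
    (mul_eq_of_eq_one ((L.branch_of_eq_zero (f := 0) rfl (by rw [update_vals_flag]; rfl) ?_ ?_
      (by norm_num)).trans (if_pos rfl)))
    (mul_eq_of_eq_one ?_)
    (L.load_mul_sqrt (k := i) (fun p => fibersStore A .weight p)
      rfl (by rw [update_vals_fst]; rfl) (fun b hb a => ?_) (fun p => hF _) (fun p hp => ?_))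
    ((congr_arg (_ * ·) ?_).trans (L.load_mul_sqrt (k := j)
      (fun p => fibersStore A .weight (bits (Nat.clog 2 n) i ++ p))
      rfl (by rw [update_vals_snd]; rfl) (fun b hb a => ?_) (fun p => hF _) (fun p hp => ?_)))
  · simp [AngleExpr.eval, L.eval_notFlag, L.get_state, vals, Reg.width,
      bitsVal_bits_one_one, hP, Code.of]
  · simp [AngleExpr.eval, L.eval_notFlag, L.get_state, vals, Reg.width,
      bitsVal_bits_one_one, hP, Code.of]
  · rw [L.load_of_eq_zero fun b hb a => ?_]
    simp [AngleExpr.eval, L.eval_val, hb, vals, Code.zero, Reg.width, bitsVal_bits_one_zero]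
  · simp [AngleExpr.eval, query, L.eval_val, L.eval_notFlag, hb, vals, Reg.width,
      bitsVal_bits_one_one, qram, hP, Code.of]
  · simp only [Reg.width] at hp
    rw [fibersStore_weight_eq_add A (by omega)]
  · simp [Reg.width]
  · simp [AngleExpr.eval, query, L.eval_val, L.eval_notFlag, L.map_addr, hb, vals, Reg.width,
      bitsVal_bits_one_one, qram, hP, Code.of]
  · simp only [Reg.width] at hp
    rw [fibersStore_weight_eq_add A (by simp [length_bits]; omega)]
    simp only [List.append_assoc]

/-- For the zero block, the flag of the column is not rotated, so that it stays `0`. -/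
lemma mat_colPrep_inr_inr (k l : Fin m) :
    Circuit.mat (qram A S Y) L.colPrep
      (L.state (vals 0 (.of (n := n) (.inr k)) (.of (n := n) (.inr l))))
      (L.state (vals 0 (.of (n := n) (.inr k)) .zero)) = 0 := by
  set P : Code := .of (n := n) (.inr k) with hP
  rw [colPrep, L.mat_prep (f := 1) (k := l) (i := 0) (j := 0) (v := vals 0 P .zero)
    (v₁ := vals 0 P ⟨1, 0, 0, 0⟩) (v₂ := vals 0 P (.of (n := n) (.inr l)))
    (v₃ := vals 0 P (.of (n := n) (.inr l)))
    (v₄ := vals 0 P (.of (n := n) (.inr l)))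
    (by rw [update_vals_flag]; rfl) (by rw [update_vals_idx]; rfl) (by rw [update_vals_fst]; rfl)
    (by rw [update_vals_snd]; rfl), L.branch_of_eq_zero (f := 1) rfl (by rw [update_vals_flag]; rfl)
    ?_ ?_ (by norm_num), if_neg (by norm_num), mul_zero]
  · simp [AngleExpr.eval, L.eval_notFlag, L.get_state, vals, Reg.width,
      bitsVal_bits_one_one, hP, Code.of]
  · simp [AngleExpr.eval, L.eval_notFlag, L.get_state, vals, Reg.width,
      bitsVal_bits_one_one, hP, Code.of]

end Layout

lemma sign_mul_real (x y : ℝ) : Real.sign (x * y) = Real.sign x * Real.sign y := by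
  rcases lt_trichotomy x 0 with hx | rfl | hx <;> rcases lt_trichotomy y 0 with hy | rfl | hy <;>
    simp [Real.sign_of_neg, Real.sign_of_pos, *, mul_pos_of_neg_of_neg, mul_neg_of_neg_of_pos,
      mul_neg_of_pos_of_neg]

namespace Layout

variable {n m q : ℕ} (L : Layout n m q)
  (A : Fin m → Matrix (Fin n) (Fin n) ℝ) (S Y : Matrix (Fin n) (Fin n) ℝ)

/-! ### The circuit -/

/-- Encode a column and prepare the superposition of rows; the phase of each branch is the sign of the
entry of `M₂`. -/
def colCircuit : Circuit (Store × Field) q :=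
  write 1 (.le (.const ((n * n + m : ℕ) : ℤ)) (L.val .data)) (L.reg .errCol) ++
  (L.encode true (.le (.add (L.val .data) (.const 1)) (.const m)) m 0 ++
  (L.rowPrep ++ phase L.signExpr (L.reg .sgn)))

/-- Encode a row and prepare the superposition of columns. -/
def rowCircuit : Circuit (Store × Field) q :=
  write 1 (.le (.const ((n * n + m : ℕ) : ℤ)) (L.val .data)) (L.reg .errRow) ++
  (L.encode false (.le (.const ((n * n : ℕ) : ℤ)) (L.val .data)) 0 (n * n) ++ L.colPrep)

lemma targets_encode {κ : Type} (c : Bool) (F : AngleExpr κ q) (o₀ o₁ : ℕ) :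
    Circuit.targets (L.encode c F o₀ o₁) = L.reg (.flag c) ++ (L.reg (.fst c) ++
      (L.reg (.snd c) ++ (L.reg (.idx c) ++ (L.reg .data).reverse))) := by
  have h : ∀ c : Circuit κ q, Circuit.targets c.reverse = (Circuit.targets c).reverse :=
    fun c => List.map_reverse
  simp only [encode, targets_append, targets_write, h]

lemma targets_colCircuit : Circuit.targets L.colCircuit = L.reg .errCol ++
    ((L.reg (.flag true) ++ (L.reg (.fst true) ++ (L.reg (.snd true) ++ (L.reg (.idx true) ++
      (L.reg .data).reverse)))) ++ ((L.reg (.flag false) ++ (L.reg (.idx false) ++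
      (L.reg (.fst false) ++ L.reg (.snd false)))) ++ L.reg .sgn)) := by
  simp only [colCircuit, targets_append, targets_write, targets_encode, rowPrep, targets_prep,
    targets_phase]

lemma targets_rowCircuit : Circuit.targets L.rowCircuit = L.reg .errRow ++
    ((L.reg (.flag false) ++ (L.reg (.fst false) ++ (L.reg (.snd false) ++ (L.reg (.idx false) ++
      (L.reg .data).reverse)))) ++ (L.reg (.flag true) ++ (L.reg (.idx true) ++
      (L.reg (.fst true) ++ L.reg (.snd true))))) := by
  simp only [rowCircuit, targets_append, targets_write, targets_encode, colPrep, targets_prep]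

section

variable {mem : Store × Field → List Bool → ℝ}

lemma write_err_sends {e : Reg} (he : e ≠ .data) (hw : e.width n m = 1) {v : Reg → ℕ} (hv : v e = 0)
    (hd : v .data < 2 ^ Reg.data.width n m) :
    Circuit.Sends mem (write 1 (.le (.const ((n * n + m : ℕ) : ℤ)) (L.val .data)) (L.reg e))
      (L.state v) (L.state (update v e (if n * n + m ≤ v .data then 1 else 0))) := by
  have h := L.write_sends (mem := mem) (c := 1) one_pos
    (V := .le (.const ((n * n + m : ℕ) : ℤ)) (L.val .data))
    (x := if n * n + m ≤ v .data then 1 else 0) hv (fun b hb => ?_) ?_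
  · rwa [Nat.div_one] at h
  · simp only [AngleExpr.eval, L.eval_val_of_get (hb .data he.symm) hd]
    norm_cast
  · rw [hw]; split_ifs <;> norm_num

/-- The number of a row: `n i + j` for a pair and `n² + k` for an index. -/
def rowNum : (Fin n × Fin n) ⊕ Fin m → ℕ :=
  Sum.elim (fun p => 0 + (n * p.1 + p.2)) fun k => n * n + k

/-- The number of a column: `m + n i + j` for a pair and `k` for an index. -/
def colNum : (Fin n × Fin n) ⊕ Fin m → ℕ :=
  Sum.elim (fun p => m + (n * p.1 + p.2)) fun k => 0 + k

lemma pair_lt (p : Fin n × Fin n) : n * (p.1 : ℕ) + p.2 < n * n := by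
  have h1 : n * ((p.1 : ℕ) + 1) ≤ n * n := Nat.mul_le_mul_left n p.1.2
  have h2 := p.2.2
  rw [mul_add] at h1
  omega

/-- On the number of a column, the classical part of the circuit leaves just the code of the column. -/
lemma mat_colCircuit (hn : 0 < n) (z : (Fin n × Fin n) ⊕ Fin m) (β : Fin q → Bool) :
    Circuit.mat mem L.colCircuit β (L.state (vals (colNum z) .zero .zero)) =
      Circuit.mat mem (L.rowPrep ++ phase L.signExpr (L.reg .sgn)) β
        (L.state (vals 0 .zero (.of z))) := by
  have hN := Nat.le_pow_clog (b := 2) (by norm_num) (n * n + m)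
  have hlt : colNum z < n * n + m := by
    rcases z with p | k
    · have := pair_lt p
      simp only [colNum, Sum.elim_inl]; omega
    · have := k.2
      simp only [colNum, Sum.elim_inr]; omega
  have h₁ := L.write_err_sends (mem := mem) (e := .errCol) (by simp) rfl
    (v := vals (colNum z) .zero .zero) rfl (hlt.trans_le hN)
  rw [if_neg (show ¬ n * n + m ≤ vals (colNum z) .zero .zero .data from not_le.2 hlt),
    show update (vals (colNum z) .zero .zero) .errCol 0 = vals (colNum z) .zero .zero from
      update_eq_self .errCol (vals (colNum z) .zero .zero)] at h₁
  rw [colCircuit, h₁.mat_append]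
  have h₂ := L.encode_sends_of (mem := mem) (c := true)
    (F := .le (.add (L.val .data) (.const 1)) (.const m)) (o₀ := m) (o₁ := 0)
    (v := vals (colNum z) .zero .zero) z rfl hlt rfl rfl rfl rfl (fun b hb => ?_) hn
  · rw [h₂.mat_append]
    congr 2
    funext r
    rcases r with _ | _ | _ | _ | c | c | c | c <;> (try cases c) <;> simp [vals, Code.zero]
  · simp only [AngleExpr.eval, L.eval_val_of_get hb (hlt.trans_le hN)]
    rcases z with p | k
    · rw [if_neg]
      · simp [Code.of]
      · have : ¬ colNum (m := m) (.inl p) + 1 ≤ m := by simp only [colNum, Sum.elim_inl]; omega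
        simp only [vals]
        exact_mod_cast this
    · rw [if_pos]
      · simp [Code.of]
      · have : colNum (n := n) (.inr k) + 1 ≤ m := by
          have := k.2
          simp only [colNum, Sum.elim_inr]; omega
        simp only [vals]
        exact_mod_cast this

/-- On the number of a row, the classical part of the circuit leaves just the code of the row. -/
lemma mat_rowCircuit (hn : 0 < n) (z : (Fin n × Fin n) ⊕ Fin m) (β : Fin q → Bool) :
    Circuit.mat mem L.rowCircuit β (L.state (vals (rowNum z) .zero .zero)) =
      Circuit.mat mem L.colPrep β (L.state (vals 0 (.of z) .zero)) := by
  have hN := Nat.le_pow_clog (b := 2) (by norm_num) (n * n + m)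
  have hlt : rowNum z < n * n + m := by
    rcases z with p | k
    · have := pair_lt p
      simp only [rowNum, Sum.elim_inl]; omega
    · have := k.2
      simp only [rowNum, Sum.elim_inr]; omega
  have h₁ := L.write_err_sends (mem := mem) (e := .errRow) (by simp) rfl
    (v := vals (rowNum z) .zero .zero) rfl (hlt.trans_le hN)
  rw [if_neg (show ¬ n * n + m ≤ vals (rowNum z) .zero .zero .data from not_le.2 hlt),
    show update (vals (rowNum z) .zero .zero) .errRow 0 = vals (rowNum z) .zero .zero from
      update_eq_self .errRow (vals (rowNum z) .zero .zero)] at h₁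
  rw [rowCircuit, h₁.mat_append]
  have h₂ := L.encode_sends_of (mem := mem) (c := false)
    (F := .le (.const ((n * n : ℕ) : ℤ)) (L.val .data)) (o₀ := 0) (o₁ := n * n)
    (v := vals (rowNum z) .zero .zero) z rfl hlt rfl rfl rfl rfl (fun b hb => ?_) hn
  · rw [h₂.mat_append]
    congr 2
    funext r
    rcases r with _ | _ | _ | _ | c | c | c | c <;> (try cases c) <;> simp [vals, Code.zero]
  · simp only [AngleExpr.eval, L.eval_val_of_get hb (hlt.trans_le hN)]
    rcases z with p | k
    · rw [if_neg]
      · simp [Code.of]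
      · have : ¬ n * n ≤ rowNum (m := m) (.inl p) := by
          have := pair_lt p
          simp only [rowNum, Sum.elim_inl]; omega
        simp only [vals]
        exact_mod_cast this
    · rw [if_pos]
      · simp [Code.of]
      · have : n * n ≤ rowNum (n := n) (.inr k) := by simp only [rowNum, Sum.elim_inr]; omega
        simp only [vals]
        exact_mod_cast this

/-- For data which are not the number of a row or a column, the error flag makes the prepared states
orthogonal. -/
lemma sum_eq_zero_of_le {d d' : ℕ} (hd : d < 2 ^ Reg.data.width n m)
    (hd' : d' < 2 ^ Reg.data.width n m) (h : n * n + m ≤ d ∨ n * n + m ≤ d') :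
    ∑ β, Circuit.mat mem L.rowCircuit β (L.state (vals d .zero .zero)) *
      Circuit.mat mem L.colCircuit β (L.state (vals d' .zero .zero)) = 0 := by
  refine Finset.sum_eq_zero fun β _ => ?_
  by_contra hne
  obtain ⟨h₁, h₂⟩ := mul_ne_zero_iff.1 hne
  have key : ∀ {e : Reg}, e.width n m = 1 → L.get β e = bits (e.width n m) 0 →
      L.get β e = bits (e.width n m) 1 → False := by
    intro e hw h0 h1
    have := bits_inj (by simp) (by simp [hw]) (h0.symm.trans h1)
    omega
  rcases h with h | h
  · have hs := L.write_err_sends (mem := mem) (e := .errRow) (by simp) rfl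
      (v := vals d .zero .zero) rfl hd
    rw [if_pos (show n * n + m ≤ vals d .zero .zero .data from h)] at hs
    rw [rowCircuit, hs.mat_append] at h₁
    refine key (e := .errRow) rfl ?_ ?_
    · rw [L.get_eq_of_mat_ne_zero (r := .errRow) ?_ h₂, get_state]
      · rfl
      · simp [targets_colCircuit, L.disjoint_reg]
    · rw [L.get_eq_of_mat_ne_zero (r := .errRow) ?_ h₁, get_state, update_self]
      simp [targets_append, targets_encode, colPrep, targets_prep, L.disjoint_reg]
  · have hs := L.write_err_sends (mem := mem) (e := .errCol) (by simp) rfl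
      (v := vals d' .zero .zero) rfl hd'
    rw [if_pos (show n * n + m ≤ vals d' .zero .zero .data from h)] at hs
    rw [colCircuit, hs.mat_append] at h₂
    refine key (e := .errCol) rfl ?_ ?_
    · rw [L.get_eq_of_mat_ne_zero (r := .errCol) ?_ h₁, get_state]
      · rfl
      · simp [targets_rowCircuit, L.disjoint_reg]
    · rw [L.get_eq_of_mat_ne_zero (r := .errCol) ?_ h₂, get_state, update_self]
      simp [targets_append, targets_encode, rowPrep, targets_prep, targets_phase, L.disjoint_reg]

/-- Only the branch which holds the codes of the given row and of the given column contributes to the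
inner product of the two prepared states. -/
lemma sum_eq_mul (P Q : Code) :
    ∑ β, Circuit.mat mem L.colPrep β (L.state (vals 0 P .zero)) *
      Circuit.mat mem (L.rowPrep ++ phase L.signExpr (L.reg .sgn)) β (L.state (vals 0 .zero Q)) =
    Circuit.mat mem L.colPrep (L.state (vals 0 P Q)) (L.state (vals 0 P .zero)) *
      (Circuit.mat mem (phase L.signExpr (L.reg .sgn)) (L.state (vals 0 P Q))
        (L.state (vals 0 P Q)) *
      Circuit.mat mem L.rowPrep (L.state (vals 0 P Q)) (L.state (vals 0 .zero Q))) := by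
  have happ : Circuit.mat mem (L.rowPrep ++ phase L.signExpr (L.reg .sgn)) (L.state (vals 0 P Q))
      (L.state (vals 0 .zero Q)) =
      Circuit.mat mem (phase L.signExpr (L.reg .sgn)) (L.state (vals 0 P Q))
        (L.state (vals 0 P Q)) *
      Circuit.mat mem L.rowPrep (L.state (vals 0 P Q)) (L.state (vals 0 .zero Q)) := by
    refine Circuit.mat_append_apply ?_ (fun _ _ => rfl) (fun w hw => ?_)
    · simp [targets_phase, rowPrep, targets_prep, L.disjoint_reg]
    · simp only [rowPrep, targets_prep, List.mem_append, not_or] at hw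
      obtain ⟨r, hr⟩ := L.exists_mem_reg w
      refine L.eq_of_get_eq ?_ hr
      rw [get_state, get_state]
      rcases r with _ | _ | _ | _ | c | c | c | c <;> (try cases c) <;>
        first | rfl | simp [hr] at hw
  rw [Finset.sum_eq_single (L.state (vals 0 P Q)), happ]
  · intro β _ hβ
    by_contra hne
    obtain ⟨h₁, h₂⟩ := mul_ne_zero_iff.1 hne
    refine hβ (L.ext fun r => ?_)
    have g₁ := fun h => L.get_eq_of_mat_ne_zero (r := r) h h₁
    have g₂ := fun h => L.get_eq_of_mat_ne_zero (r := r) h h₂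
    simp only [targets_append, targets_phase, colPrep, rowPrep, targets_prep, get_state,
      List.disjoint_append_left] at g₁ g₂ ⊢
    rcases r with _ | _ | _ | _ | c | c | c | c <;> (try cases c) <;>
      first
        | exact (g₁ (by simp [L.disjoint_reg])).trans rfl
        | exact (g₂ (by simp [L.disjoint_reg])).trans rfl
  · simp

end

/-- The branch amplitudes multiply to the entry of `M₂` divided by the norm of `M₂`. -/
lemma frobeniusNorm_mul_amplitude (hS : S.IsSymm) (hY : Y.IsSymm)
    (z z' : (Fin n × Fin n) ⊕ Fin m) :
    frobeniusNorm (newtonM2 A S Y) *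
      (Circuit.mat (qram A S Y) L.colPrep (L.state (vals 0 (.of z) (.of z')))
        (L.state (vals 0 (.of z) .zero)) *
      (Circuit.mat (qram A S Y) (phase L.signExpr (L.reg .sgn)) (L.state (vals 0 (.of z) (.of z')))
        (L.state (vals 0 (.of z) (.of z'))) *
      Circuit.mat (qram A S Y) L.rowPrep (L.state (vals 0 (.of z) (.of z')))
        (L.state (vals 0 .zero (.of z'))))) =
    newtonM2 A S Y (rowIndex n m z) (colIndex n m z'.swap) := by
  have hph : ∀ (P Q : Code) (r : ℝ),
      L.signExpr.eval (qram A S Y) (L.state (vals 0 P Q)) = Real.sign r →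
      Circuit.mat (qram A S Y) (phase L.signExpr (L.reg .sgn)) (L.state (vals 0 P Q))
        (L.state (vals 0 P Q)) * |r| = r := fun P Q r hr =>
    phase_mul_abs (L.length_reg _) (fun w hw => L.state_eq_false rfl hw) hr
  have hYinv : ∀ i j, Y⁻¹ i j = Y⁻¹ j i := fun i j => by
    have : (Y⁻¹).transpose = Y⁻¹ := by rw [Matrix.transpose_nonsing_inv, hY.eq]
    exact congr_fun (congr_fun this j) i
  rw [newtonM2_apply]
  rcases z with ⟨i, j⟩ | k <;> rcases z' with ⟨a, b⟩ | l
  · have h₁ := L.mat_rowPrep_inl A S Y i j (.of (m := m) (.inl (a, b)))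
    have h₂ := L.mat_colPrep_inl_inl A S Y i j a b
    have h₃ := hph (.of (m := m) (.inl (i, j))) (.of (m := m) (.inl (a, b))) (Y⁻¹ j a * S i b) (by
      rw [sign_mul_real, ← matrixStore_sign_leaf, ← matrixStore_sign_leaf]
      simp [signExpr, AngleExpr.eval, query, L.eval_val, L.eval_notFlag, L.map_addr, L.get_state,
        vals, Reg.width, bitsVal_bits_one_zero, qram, Code.of])
    rw [Sum.swap_inl, Matrix.fromBlocks_apply₁₂, tilde_mul_hat_apply, hYinv, ← hS.apply b i,
      ← h₃, abs_mul, ← h₂, ← h₁]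
    ring
  · have h₁ := L.mat_rowPrep_inl A S Y i j (.of (n := n) (.inr l))
    have h₂ := L.mat_colPrep_inl_inr A S Y i j l
    have h₃ := hph (.of (m := m) (.inl (i, j))) (.of (n := n) (.inr l)) (A l i j) (by
      rw [← fibersStore_sign_leaf]
      simp [signExpr, AngleExpr.eval, query, L.eval_val, L.eval_notFlag, L.map_addr, L.get_state,
        vals, Reg.width, bitsVal_bits_one_zero, bitsVal_bits_one_one, qram, Code.of])
    rw [Sum.swap_inr, Matrix.fromBlocks_apply₁₁, Matrix.transpose_apply, vecMatrix,
      ← h₃, ← h₂, ← h₁]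
    ring
  · obtain ⟨x, h₁, h₁'⟩ := L.mat_rowPrep_inr A S Y k a b
    have h₂ := L.mat_colPrep_inr_inl A S Y k a b
    have h₃ := hph (.of (n := n) (.inr k)) (.of (m := m) (.inl (a, b))) (A k a b) (by
      rw [← fibersStore_sign_leaf]
      simp [signExpr, AngleExpr.eval, query, L.eval_val, L.eval_notFlag, L.map_addr, L.get_state,
        vals, Reg.width, bitsVal_bits_one_zero, bitsVal_bits_one_one, qram, Code.of])
    rw [Sum.swap_inl, Matrix.fromBlocks_apply₂₂, vecMatrix]
    conv_rhs => rw [← h₃, ← h₁', ← h₂]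
    linear_combination (Circuit.mat (qram A S Y) L.colPrep _ _ *
      Circuit.mat (qram A S Y) (phase L.signExpr (L.reg .sgn)) _ _) * h₁
  · rw [L.mat_colPrep_inr_inr, Sum.swap_inr, Matrix.fromBlocks_apply₂₁]
    simp

end Layout

/-! ### Running time -/

section Time

variable {κ : Type} {q : ℕ}

lemma Circuit.time_append (c₁ c₂ : Circuit κ q) :
    Circuit.time (c₁ ++ c₂) = Circuit.time c₁ + Circuit.time c₂ := by simp [Circuit.time]

lemma Circuit.time_reverse (c : Circuit κ q) : Circuit.time c.reverse = Circuit.time c := by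
  simp [Circuit.time, List.map_reverse]

lemma Circuit.time_cons (g : Gate κ q) (c : Circuit κ q) :
    Circuit.time (g :: c) = g.time + Circuit.time c := by simp [Circuit.time]

lemma size_valExpr (R : List (Fin q)) :
    (valExpr R : AngleExpr κ q).size ≤ R.length * (R.length + 4) + 1 := by
  induction R with
  | nil => simp [valExpr, AngleExpr.size]
  | cons t R ih =>
    simp only [valExpr, AngleExpr.size, Int.natAbs_natCast, Nat.size_pow, List.length_cons]
    nlinarith

lemma time_writeAux {c s B : ℕ} {V : AngleExpr κ q} (hc : Nat.size c ≤ s + 1) (hV : V.size ≤ B)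
    {R T : List (Fin q)} (h : R.length + T.length ≤ s) :
    Circuit.time (writeAux c V R T) ≤ T.length * (B + (s * s + 7 * s + 12)) := by
  induction T generalizing R with
  | nil => simp [writeAux, Circuit.time]
  | cons t T ih =>
    have h₁ := ih (R := R ++ [t]) (by simp at h ⊢; omega)
    have h₂ := size_valExpr (κ := κ) R
    have hR : R.length ≤ s := by simp at h; omega
    have hT : T.length + 1 ≤ s := by simp at h; omega
    have h₃ : R.length * (R.length + 4) ≤ s * (s + 4) := Nat.mul_le_mul hR (by omega)
    rw [writeAux, Circuit.time_cons]
    simp only [Gate.time, AngleExpr.size, Int.natAbs_natCast, Nat.size_pow, List.length_cons,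
      Int.natAbs_zero, Nat.size_zero]
    nlinarith

lemma time_write {c s B : ℕ} {V : AngleExpr κ q} (hc : Nat.size c ≤ s + 1) (hV : V.size ≤ B)
    {T : List (Fin q)} (h : T.length ≤ s) :
    Circuit.time (write c V T) ≤ s * (B + (s * s + 7 * s + 12)) :=
  (time_writeAux (R := []) hc hV (by simpa)).trans (Nat.mul_le_mul_right _ h)

lemma time_loadAux {s B : ℕ} {W : List (Fin q ⊕ Bool) → AngleExpr κ q}
    (hW : ∀ a, a.length ≤ s → (W a).size ≤ B) {R T : List (Fin q)} (h : R.length + T.length ≤ s) :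
    Circuit.time (loadAux W R T) ≤ T.length * (2 * B + 3) := by
  induction T generalizing R with
  | nil => simp [loadAux, Circuit.time]
  | cons t T ih =>
    have h₁ := ih (R := R ++ [t]) (by simp at h ⊢; omega)
    have h₂ := fun v => hW (R.map Sum.inl ++ [Sum.inr v]) (by simp at h ⊢; omega)
    have h₃ := h₂ false
    have h₄ := h₂ true
    rw [loadAux, Circuit.time_cons]
    simp only [Gate.time, AngleExpr.size, List.length_cons]
    nlinarith

lemma time_load {s B : ℕ} {W : List (Fin q ⊕ Bool) → AngleExpr κ q}
    (hW : ∀ a, a.length ≤ s → (W a).size ≤ B) {T : List (Fin q)} (h : T.length ≤ s) :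
    Circuit.time (load W T) ≤ s * (2 * B + 3) :=
  (time_loadAux (R := []) hW (by simpa)).trans (Nat.mul_le_mul_right _ h)

lemma time_branch {s B : ℕ} {e₀ e₁ : AngleExpr κ q} (h₀ : e₀.size ≤ B) (h₁ : e₁.size ≤ B)
    {T : List (Fin q)} (h : T.length ≤ s) :
    Circuit.time (branch e₀ e₁ T) ≤ s * (2 * B + 3) := by
  refine le_trans ?_ (Nat.mul_le_mul_right _ h)
  simp only [Circuit.time, branch, List.map_map, Function.comp_def, List.map_const',
    List.sum_replicate, smul_eq_mul, Gate.time, AngleExpr.size]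
  exact Nat.mul_le_mul_left _ (by omega)

lemma time_phase {s B : ℕ} {e : AngleExpr κ q} (h₀ : e.size ≤ B)
    {T : List (Fin q)} (h : T.length ≤ s) :
    Circuit.time (phase e T) ≤ s * (2 * B + 3) := by
  refine le_trans ?_ (Nat.mul_le_mul_right _ h)
  simp only [Circuit.time, phase, List.map_map, Function.comp_def, List.map_const',
    List.sum_replicate, smul_eq_mul, Gate.time, AngleExpr.size, Int.natAbs_zero, Nat.size_zero]
  exact Nat.mul_le_mul_left _ (by omega)

end Time

namespace Layout

variable {n m q : ℕ} (L : Layout n m q)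

lemma length_addr (r : Reg) : (L.addr r).length = r.width n m := by simp [addr, L.length_reg]

lemma size_val {κ : Type} (hn : 0 < n) (hm : 0 < m) (r : Reg) :
    (L.val r : AngleExpr κ q).size ≤
      6 * (Nat.clog 2 (n * n + m) * Nat.clog 2 (n * n + m)) := by
  have h1 := one_le_clog hn hm
  have hr := r.width_le hn hm
  have := size_valExpr (κ := κ) (L.reg r)
  rw [L.length_reg] at this
  have h2 : r.width n m * (r.width n m + 4) ≤ Nat.clog 2 (n * n + m) * (Nat.clog 2 (n * n + m) + 4) :=
    Nat.mul_le_mul hr (by omega)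
  rw [val]
  nlinarith

lemma size_notFlag {κ : Type} (hn : 0 < n) (hm : 0 < m) (c : Bool) :
    (L.notFlag c : AngleExpr κ q).size ≤
      12 * (Nat.clog 2 (n * n + m) * Nat.clog 2 (n * n + m)) := by
  have h1 := one_le_clog hn hm
  have := L.size_val (κ := κ) hn hm (.flag c)
  simp only [notFlag, AngleExpr.size, Int.natAbs_neg, Int.natAbs_one, Nat.size_one]
  nlinarith

lemma natSize_le {x : ℕ} (hx : x ≤ n * n + m) : Nat.size x ≤ Nat.clog 2 (n * n + m) + 1 := by
  have hN := Nat.le_pow_clog (b := 2) (by norm_num) (n * n + m)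
  rw [Nat.size_le, pow_succ]
  have : 0 < 2 ^ Nat.clog 2 (n * n + m) := by positivity
  omega

lemma time_encode_le {κ : Type} (hn : 0 < n) (hm : 0 < m) (c : Bool) {F : AngleExpr κ q} {o₀ o₁ : ℕ}
    (hF : F.size ≤ 100 * (Nat.clog 2 (n * n + m) * Nat.clog 2 (n * n + m)))
    (h₀ : o₀ ≤ n * n + m) (h₁ : o₁ ≤ n * n + m) :
    Circuit.time (L.encode c F o₀ o₁) ≤ 5 * (203 * Nat.clog 2 (n * n + m) ^ 3) := by
  have hn2 : n ≤ n * n := Nat.le_mul_of_pos_left n hn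
  have hv := L.size_val (κ := κ) hn hm
  have hf := L.size_notFlag (κ := κ) hn hm
  have hd := hv .data
  have hvf := hv (.flag c)
  have hvi := hv (.fst c)
  have hvj := hv (.snd c)
  have hvk := hv (.idx c)
  have hfc := hf c
  have hsn : Nat.size n ≤ _ := natSize_le (n := n) (m := m) (by omega)
  have hs1 : Nat.size 1 ≤ _ := natSize_le (n := n) (m := m) (x := 1) (by omega)
  have hs₀ := natSize_le h₀
  have hs₁ := natSize_le h₁
  have hl : ∀ r, (L.reg r).length ≤ Nat.clog 2 (n * n + m) := fun r => by
    rw [L.length_reg]; exact r.width_le hn hm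
  have hs := one_le_clog hn hm
  generalize Nat.clog 2 (n * n + m) = s at *
  have hq : s ≤ s * s := Nat.le_mul_of_pos_left s hs
  have key : s * (100 * (s * s) + (s * s + 7 * s + 12)) ≤ 203 * s ^ 3 := by
    have : s * (100 * (s * s) + (s * s + 7 * s + 12)) ≤ s * (203 * (s * s)) :=
      Nat.mul_le_mul_left _ (by omega)
    refine this.trans_eq (by ring)
  simp only [encode, Circuit.time_append, Circuit.time_reverse]
  have t₁ := time_write hs1 hF (hl (.flag c))
  have t₂ := time_write hsn (B := 100 * (s * s)) (V := .mul (L.notFlag c)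
    (.add (L.val .data) (.const (-o₀)))) (by
      simp only [AngleExpr.size, Int.natAbs_neg, Int.natAbs_natCast]; omega) (hl (.fst c))
  have t₃ := time_write hs1 (B := 100 * (s * s)) (V := .add (.mul (L.notFlag c)
    (.add (L.val .data) (.const (-o₀)))) (.mul (.const (-n)) (L.val (.fst c)))) (by
      simp only [AngleExpr.size, Int.natAbs_neg, Int.natAbs_natCast]; omega) (hl (.snd c))
  have t₄ := time_write hs1 (B := 100 * (s * s)) (V := .mul (L.val (.flag c))
    (.add (L.val .data) (.const (-o₁)))) (by
      simp only [AngleExpr.size, Int.natAbs_neg, Int.natAbs_natCast]; omega) (hl (.idx c))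
  have t₅ := time_write hs1 (B := 100 * (s * s)) (V := .add (.add (.mul (.const n) (L.val (.fst c)))
    (L.val (.snd c))) (.add (L.val (.idx c)) (.add (.mul (L.notFlag c) (.const o₀))
      (.mul (L.val (.flag c)) (.const o₁))))) (by
      simp only [AngleExpr.size, Int.natAbs_natCast]; omega) (hl .data)
  linarith

lemma time_prep_le (hn : 0 < n) (hm : 0 < m) (c : Bool) {e₀ e₁ : AngleExpr (Store × Field) q}
    {W₁ W₂ W₃ : List (Fin q ⊕ Bool) → AngleExpr (Store × Field) q}
    (h₀ : e₀.size ≤ 100 * (Nat.clog 2 (n * n + m) * Nat.clog 2 (n * n + m)))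
    (h₁ : e₁.size ≤ 100 * (Nat.clog 2 (n * n + m) * Nat.clog 2 (n * n + m)))
    (hW₁ : ∀ a, a.length ≤ Nat.clog 2 (n * n + m) →
      (W₁ a).size ≤ 100 * (Nat.clog 2 (n * n + m) * Nat.clog 2 (n * n + m)))
    (hW₂ : ∀ a, a.length ≤ Nat.clog 2 (n * n + m) →
      (W₂ a).size ≤ 100 * (Nat.clog 2 (n * n + m) * Nat.clog 2 (n * n + m)))
    (hW₃ : ∀ a, a.length ≤ Nat.clog 2 (n * n + m) →
      (W₃ a).size ≤ 100 * (Nat.clog 2 (n * n + m) * Nat.clog 2 (n * n + m))) :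
    Circuit.time (L.prep c e₀ e₁ W₁ W₂ W₃) ≤ 4 * (203 * Nat.clog 2 (n * n + m) ^ 3) := by
  have hl : ∀ r, (L.reg r).length ≤ Nat.clog 2 (n * n + m) := fun r => by
    rw [L.length_reg]; exact r.width_le hn hm
  have hs := one_le_clog hn hm
  generalize Nat.clog 2 (n * n + m) = s at *
  have hq : s ≤ s * s := Nat.le_mul_of_pos_left s hs
  have key : s * (2 * (100 * (s * s)) + 3) ≤ 203 * s ^ 3 := by
    have : s * (2 * (100 * (s * s)) + 3) ≤ s * (203 * (s * s)) :=
      Nat.mul_le_mul_left _ (by omega)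
    refine this.trans_eq (by ring)
  simp only [prep, Circuit.time_append]
  have t₁ := time_branch h₀ h₁ (hl (.flag c))
  have t₂ := time_load hW₁ (hl (.idx c))
  have t₃ := time_load hW₂ (hl (.fst c))
  have t₄ := time_load hW₃ (hl (.snd c))
  linarith

lemma time_err_le {κ : Type} (hn : 0 < n) (hm : 0 < m) (e : Reg) :
    Circuit.time (write 1 (.le (.const ((n * n + m : ℕ) : ℤ)) (L.val .data)) (L.reg e) : Circuit κ q) ≤
      203 * Nat.clog 2 (n * n + m) ^ 3 := by
  have hs1 : Nat.size 1 ≤ _ := natSize_le (n := n) (m := m) (x := 1) (by omega)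
  have hsN := natSize_le (n := n) (m := m) le_rfl
  have hd := L.size_val (κ := κ) hn hm .data
  have hl : (L.reg e).length ≤ Nat.clog 2 (n * n + m) := by
    rw [L.length_reg]; exact e.width_le hn hm
  have hs := one_le_clog hn hm
  generalize hN : n * n + m = N at *
  generalize Nat.clog 2 N = s at *
  have hq : s ≤ s * s := Nat.le_mul_of_pos_left s hs
  have t := time_write hs1 (B := 100 * (s * s)) (V := .le (.const (N : ℤ)) (L.val .data)) (by
    simp only [AngleExpr.size, Int.natAbs_natCast]; omega) hl
  refine t.trans ?_
  have : s * (100 * (s * s) + (s * s + 7 * s + 12)) ≤ s * (203 * (s * s)) :=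
    Nat.mul_le_mul_left _ (by omega)
  exact this.trans_eq (by ring)

lemma time_le (hn : 0 < n) (hm : 0 < m) :
    Circuit.time (L.colCircuit ++ L.rowCircuit.reverse) ≤
      5000 * Nat.clog 2 (n * n + m) ^ 3 := by
  have hn2 : n ≤ n * n := Nat.le_mul_of_pos_left n hn
  have hv := L.size_val (κ := Store × Field) hn hm
  have hf := L.size_notFlag (κ := Store × Field) hn hm
  have hd := hv .data
  have hv₀ := hv (.flag false)
  have hv₁ := hv (.flag true)
  have hf₀ := hf false
  have hf₁ := hf true
  have hm' := natSize_le (n := n) (m := m) (x := m) (by omega)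
  have hn' := natSize_le (n := n) (m := m) (x := n * n) (by omega)
  have ha : ∀ r, (L.addr r).length ≤ Nat.clog 2 (n * n + m) := fun r => by
    rw [L.length_addr]; exact r.width_le hn hm
  have a₀ := ha (.fst false)
  have a₁ := ha (.snd false)
  have a₂ := ha (.idx false)
  have b₀ := ha (.fst true)
  have b₁ := ha (.snd true)
  have b₂ := ha (.idx true)
  have hs := one_le_clog hn hm
  have hq : Nat.clog 2 (n * n + m) ≤ Nat.clog 2 (n * n + m) * Nat.clog 2 (n * n + m) :=
    Nat.le_mul_of_pos_left _ hs
  have e₁ := L.time_err_le (κ := Store × Field) hn hm .errCol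
  have e₂ := L.time_err_le (κ := Store × Field) hn hm .errRow
  have c₁ := L.time_encode_le (κ := Store × Field) (o₀ := m) (o₁ := 0) hn hm true
    (F := .le (.add (L.val .data) (.const 1)) (.const m)) (by
      simp only [AngleExpr.size, Int.natAbs_natCast, Int.natAbs_one, Nat.size_one]; omega)
    (by omega) (by omega)
  have c₂ := L.time_encode_le (κ := Store × Field) (o₀ := 0) (o₁ := n * n) hn hm false
    (F := .le (.const ((n * n : ℕ) : ℤ)) (L.val .data)) (by
      simp only [AngleExpr.size, Int.natAbs_natCast]; omega)
    (by omega) (by omega)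
  have p₁ : Circuit.time L.rowPrep ≤ 4 * (203 * Nat.clog 2 (n * n + m) ^ 3) := by
    refine L.time_prep_le hn hm false ?_ ?_ (fun a h => ?_) (fun a h => ?_) (fun a h => ?_) <;>
      simp only [query, AngleExpr.size, List.length_append, List.length_nil] <;> omega
  have p₂ : Circuit.time L.colPrep ≤ 4 * (203 * Nat.clog 2 (n * n + m) ^ 3) := by
    refine L.time_prep_le hn hm true ?_ ?_ (fun a h => ?_) (fun a h => ?_) (fun a h => ?_) <;>
      simp only [query, AngleExpr.size, List.length_append] <;> omega
  have p₃ : Circuit.time (phase L.signExpr (L.reg .sgn)) ≤ 203 * Nat.clog 2 (n * n + m) ^ 3 := by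
    refine (time_phase (s := Nat.clog 2 (n * n + m)) (B := 100 * (Nat.clog 2 (n * n + m) * Nat.clog 2 (n * n + m))) ?_
      (by rw [L.length_reg]; exact Reg.width_le hn hm .sgn)).trans ?_
    · simp only [signExpr, query, AngleExpr.size, List.length_append]
      omega
    · generalize Nat.clog 2 (n * n + m) = s at *
      have : s * (2 * (100 * (s * s)) + 3) ≤ s * (203 * (s * s)) :=
        Nat.mul_le_mul_left _ (by omega)
      exact this.trans_eq (by ring)
  rw [Circuit.time_append, Circuit.time_reverse, colCircuit, rowCircuit]
  simp only [Circuit.time_append]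
  linarith

end Layout

/-! ### The block encoding -/

lemma clog_le_two_mul_logb {N : ℕ} (hN : 2 ≤ N) :
    (Nat.clog 2 N : ℝ) ≤ 2 * Real.logb 2 (N : ℝ) := by
  have h1 : Nat.clog 2 N ≤ Nat.log 2 N + 1 := Nat.clog_le_of_le_pow
    (Nat.lt_pow_succ_log_self (by norm_num) N).le
  have h2 : (Nat.log 2 N : ℝ) ≤ Real.logb 2 (N : ℝ) := by
    exact_mod_cast Real.natLog_le_logb N 2
  have h3 : 1 ≤ Nat.log 2 N := Nat.log_pos (by norm_num) hN
  have h1' : (Nat.clog 2 N : ℝ) ≤ Nat.log 2 N + 1 := by exact_mod_cast h1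
  have h3' : (1 : ℝ) ≤ Nat.log 2 N := by exact_mod_cast h3
  linarith

/-- The basis states to which `topLeftBlock` refers have just a number in the data register. -/
lemma Layout.append_eq_state {n m t : ℕ} (L : Layout n m (t + Nat.clog 2 (n * n + m)))
    (hL : L.reg .data = List.ofFn (Fin.natAdd t)) (x : Fin (Nat.clog 2 (n * n + m)) → Bool) :
    Fin.append (fun _ => false) x =
      L.state (vals (Nat.ofBits fun i => x i.rev) .zero .zero) := by
  refine L.ext fun r => ?_
  rw [L.get_state]
  by_cases hr : r = .data
  · subst hr
    rw [get, hL, List.map_ofFn]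
    refine Eq.trans ?_ (ofFn_eq_bits x)
    congr 1
    funext j
    simp
  · have hv : vals (Nat.ofBits fun i => x i.rev) .zero .zero r = 0 := by
      rcases r with _ | _ | _ | _ | c | c | c | c <;> (try cases c) <;>
        first | rfl | exact absurd rfl hr
    rw [hv, bits_zero, List.eq_replicate_iff]
    refine ⟨by simp [get, L.length_reg], fun v hv => ?_⟩
    obtain ⟨w, hw, rfl⟩ := List.mem_map.1 hv
    have hd := L.disjoint_reg _ _ hr hw
    rw [hL, List.mem_ofFn] at hd
    induction w using Fin.addCases with
    | left i => simp
    | right j => exact absurd ⟨j, rfl⟩ hd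

/-- An entry of the circuit is the inner product of the two prepared states. -/
lemma Layout.mat_circuit {n m q : ℕ} (L : Layout n m q) (mem : Store × Field → List Bool → ℝ)
    (b' b : Fin q → Bool) :
    Circuit.mat mem (L.colCircuit ++ L.rowCircuit.reverse) b' b =
      ∑ β, Circuit.mat mem L.rowCircuit β b' * Circuit.mat mem L.colCircuit β b := by
  rw [Circuit.mat_append, Circuit.mat_reverse, Matrix.mul_apply]
  rfl

lemma Layout.frobeniusNorm_smul_topLeftBlock {n m t : ℕ} (hn : 0 < n)
    (L : Layout n m (t + Nat.clog 2 (n * n + m)))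
    (hL : L.reg .data = List.ofFn (Fin.natAdd t)) (A : Fin m → Matrix (Fin n) (Fin n) ℝ)
    (S Y : Matrix (Fin n) (Fin n) ℝ) (hS : S.IsSymm) (hY : Y.IsSymm) :
    (frobeniusNorm (newtonM2 A S Y) : ℂ) •
      topLeftBlock (Circuit.toMatrix (qram A S Y) (L.colCircuit ++ L.rowCircuit.reverse)) =
    qubitOperator (newtonM2 A S Y) := by
  ext x y
  rw [Matrix.smul_apply, topLeftBlock, Circuit.toMatrix_eq_map, Matrix.map_apply, L.mat_circuit,
    L.append_eq_state hL, L.append_eq_state hL, smul_eq_mul, ← Complex.ofReal_mul, qubitOperator]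
  have hx := Nat.ofBits_lt_two_pow fun i => x i.rev
  have hy := Nat.ofBits_lt_two_pow fun i => y i.rev
  split_ifs with h
  · congr 1
    obtain ⟨z, hz⟩ := (rowIndex n m).surjective ⟨_, h.1⟩
    obtain ⟨z', hz'⟩ := (colIndex n m).surjective ⟨_, h.2⟩
    have ex : (Nat.ofBits fun i => x i.rev) = Layout.rowNum z := by
      have := congr_arg Fin.val hz
      refine this.symm.trans ?_
      rcases z with p | k <;> simp [rowIndex, rowNum, finProdFinEquiv]
      ring
    have ey : (Nat.ofBits fun i => y i.rev) = Layout.colNum z'.swap := by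
      have := congr_arg Fin.val hz'
      refine this.symm.trans ?_
      rcases z' with p | k <;> simp [colIndex, colNum, finProdFinEquiv]
      ring
    rw [← hz, ← hz', ← Sum.swap_swap z', ← L.frobeniusNorm_mul_amplitude A S Y hS hY, ← L.sum_eq_mul,
      ex, ey]
    simp_rw [L.mat_rowCircuit hn, L.mat_colCircuit hn]
  · rw [L.sum_eq_zero_of_le hx hy (by omega), mul_zero, Complex.ofReal_zero]

open scoped Matrix.Norms.L2Operator in
lemma isBlockEncoding_zero_of_eq {d t : ℕ} {A : Matrix (Fin d) (Fin d) ℝ} {μ : ℝ}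
    {U : Matrix (Fin (t + Nat.clog 2 d) → Bool) (Fin (t + Nat.clog 2 d) → Bool) ℂ}
    (hU : U ∈ Matrix.unitaryGroup (Fin (t + Nat.clog 2 d) → Bool) ℂ)
    (h : (μ : ℂ) • topLeftBlock U = qubitOperator A) : IsBlockEncoding A μ t 0 U :=
  ⟨hU, by rw [h, sub_self, norm_zero]⟩

end QuantumIPM

theorem theorem7p1 :
    ∃ (C : ℝ) (a : ℕ), ∀ n m : ℕ, 0 < n → 0 < m →
      ∃ (t : ℕ) (c : QuantumIPM.Circuit (QuantumIPM.Store × QuantumIPM.Field)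
          (t + Nat.clog 2 (n * n + m))),
        (t : ℝ) ≤ C * Real.logb 2 ((n * n + m : ℕ) : ℝ) ∧
        (c.time : ℝ) ≤ C * Real.logb 2 ((n * n + m : ℕ) : ℝ) ^ a ∧
        ∀ (A : Fin m → Matrix (Fin n) (Fin n) ℝ) (S Y : Matrix (Fin n) (Fin n) ℝ),
          S.IsSymm → Y.IsSymm → IsUnit Y →
          QuantumIPM.IsBlockEncoding (QuantumIPM.newtonM2 A S Y)
            (QuantumIPM.frobeniusNorm (QuantumIPM.newtonM2 A S Y)) t 0
            (c.toMatrix (QuantumIPM.qram A S Y)) := by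
  -- `t ≤ 11 s` and the time is at most `5000 s ^ 3`, where `s = ⌈log₂ N⌉ ≤ 2 log₂ N`
  refine ⟨40000, 3, fun n m hn hm => ?_⟩
  obtain ⟨t, ht, L, hL⟩ := QuantumIPM.exists_layout hn hm
  have hN : 2 ≤ n * n + m := by
    have : 0 < n * n := by positivity
    omega
  have hlog := QuantumIPM.clog_le_two_mul_logb hN
  have hpos : (0 : ℝ) ≤ Nat.clog 2 (n * n + m) := by positivity
  refine ⟨t, L.colCircuit ++ L.rowCircuit.reverse, ?_, ?_, fun A S Y hS hY _ => ?_⟩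
  · have ht' : (t : ℝ) ≤ 11 * Nat.clog 2 (n * n + m) := by exact_mod_cast ht
    linarith
  · have hT : (QuantumIPM.Circuit.time (L.colCircuit ++ L.rowCircuit.reverse) : ℝ) ≤
        5000 * (Nat.clog 2 (n * n + m) : ℝ) ^ 3 := by exact_mod_cast L.time_le hn hm
    have h3 := pow_le_pow_left₀ hpos hlog 3
    rw [mul_pow] at h3
    linarith
  · exact QuantumIPM.isBlockEncoding_zero_of_eq (QuantumIPM.Circuit.toMatrix_mem_unitaryGroup _)
      (L.frobeniusNorm_smul_topLeftBlock hn hL A S Y hS hY)
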